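/- Consider the discrete-time linear system $x_{k+1}=Ax_k+Bu_k$, $y_k=Cx_k+Du_k$, $z_k=Ex_k+Fu_k$ with $x_k\in\mathbb R^{n_x}$, $u_k\in\mathbb R^{n_u}$, $y_k\in\mathbb R^{n_y}$, $z_k\in\mathbb R^{n_z}$, a target reference $r\in\mathbb R^{n_z}$, a horizon $N\ge 1$ and a margin $\epsilon\in(0,1)$. Let the columns of $G=[G_x^T\ G_u^T\ G_z^T]^T$ (with $n_z$ columns) be a basis of the kernel of $$Z=\begin{bmatrix}A-I&B&0\\E&F&-I\end{bmatrix},$$ and put $\bar x_v=G_xv$, $\bar u_v=G_uv$ for $v\in\mathbb R^{n_z}$. Assume: (1) $(A,B)$ is stabilizable; (2) $G_z$ is invertible; (3) $\mathcal Y=\{y\mid Yy\le h\}$ is a compact polyhedron with $0\in\operatorname{Int}\mathcal Y$; (4) $Q\succeq0$ with $(A,Q)$ detectable, and $R\succ0$. Let $P$ be the positive semidefinite solution of the Riccati equation $P=Q+A^TPA-(A^TPB)(R+B^TPB)^{-1}(B^TPA)$, and let $K=(R+B^TPB)^{-1}(B^TPA)$. Let $\mathcal R_\epsilon=\{v\mid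 (CG_x+DG_u)v\in(1-\epsilon)\mathcal Y\}$ and $r^\star=\arg\min_{v\in\mathcal R_\epsilon}\|v-r\|_2$. Let $\mathcal T$ be the set of all $(x,v)$ such that $v\in\mathcal R_\epsilon$ and the trajectory $\tilde x_0=x$, $\tilde x_{j+1}=A\tilde x_j+B\tilde u_j$, $\tilde u_j=\bar u_v-K(\tilde x_j-\bar x_v)$ satisfies $C\tilde x_j+D\tilde u_j\in\mathcal Y$ for all $j\ge0$. For given $(x,v)$ consider the optimal control problem of minimizing $$\|\xi_N-\bar x_v\|_P^2+\sum_{i=0}^{N-1}\left(\|\xi_i-\bar x_v\|_Q^2+\|\mu_i-\bar u_v\|_R^2\right)$$ over $\mu=(\mu_0,\dots,\mu_{N-1})$ subject to $\xi_0=x$, $\xi_{i+1}=A\xi_i+B\mu_i$ and $C\xi_i+D\mu_i\in\mathcal Y$ for $0\le i\le N-1$, and $(\xi_N,v)\in\mathcal T$, where $\|w\|_M^2=w^TMw$. Let $\Gamma_N$ be the set of $(x,v)$ for which it is feasible, let $\kappa(x,v)=\mu_0^\star$ be the first input of its minimizer, and let $\Lambda=\Gamma_N\cap(\mathbb R^{n_x}\times\mathcal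 R_\epsilon)$. Let $g(x)=\arg\min\{\|v-r\|_2^2\mid v\in\mathcal R_\epsilon,\ (x,v)\in\Gamma_N\}$ and consider the closed loop $$v_k=g(x_k),\qquad x_{k+1}=Ax_k+B\,\kappa(x_k,v_k).$$ Then $r^\star$ is well defined and, for every $x_0$ in the projection of $\Lambda$ onto the state coordinates, the closed-loop sequence is well defined (at every step both optimization problems have a unique minimizer) and there is a finite time $t\ge0$ such that $v_k=r^\star$ for all $k\ge t$. -/

import Mathlib

open scoped Matrix Pointwise

noncomputable section

namespace FeasGov

/-- A real square matrix is Schur (discrete-time stable) if all its complex eigenvalues lie in the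
open unit disc. -/
def IsSchur {n : ℕ} (M : Matrix (Fin n) (Fin n) ℝ) : Prop :=
  ∀ z ∈ spectrum ℂ (M.map (algebraMap ℝ ℂ)), ‖z‖ < 1

/-- `(A, B)` is stabilizable: some linear state feedback makes the closed loop Schur. -/
def IsStabilizable {n m : ℕ} (A : Matrix (Fin n) (Fin n) ℝ) (B : Matrix (Fin n) (Fin m) ℝ) : Prop :=
  ∃ K : Matrix (Fin m) (Fin n) ℝ, IsSchur (A - B * K)

/-- `(A, H)` is detectable: some output injection makes the error dynamics Schur. -/
def IsDetectable {n m : ℕ} (A : Matrix (Fin n) (Fin n) ℝ) (H : Matrix (Fin m) (Fin n) ℝ) : Prop :=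
  ∃ L : Matrix (Fin n) (Fin m) ℝ, IsSchur (A - L * H)

/-- The squared weighted norm `‖x‖²_M = xᵀ M x`. -/
def wsq {n : ℕ} (M : Matrix (Fin n) (Fin n) ℝ) (x : Fin n → ℝ) : ℝ := x ⬝ᵥ (M *ᵥ x)

/-- The Euclidean norm on `ℝⁿ`. -/
def enorm2 {n : ℕ} (x : Fin n → ℝ) : ℝ := ‖(WithLp.toLp 2 x : EuclideanSpace ℝ (Fin n))‖

/-- `a` minimizes `f` over `S`. -/
def IsMinimizer {α : Type*} (f : α → ℝ) (S : Set α) (a : α) : Prop := a ∈ S ∧ IsMinOn f S a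

/-- A minimizer of `f` over `S` (an arbitrary point if there is none). -/
def argmin {α : Type*} [Nonempty α] (f : α → ℝ) (S : Set α) : α :=
  Classical.epsilon (IsMinimizer f S)

/-- The data: the system matrices, the parameterization `(Gx, Gu, Gz)` of the equilibria,
the half-space representation `Y y ≤ h` of the constraint set, the margin `ε`, the weights
`Q`, `R`, `P`, and the target reference `r`. No property is assumed here. -/
structure Setup (nx nu ny nz m : ℕ) where
  A : Matrix (Fin nx) (Fin nx) ℝ
  B : Matrix (Fin nx) (Fin nu) ℝ
  C : Matrix (Fin ny) (Fin nx) ℝ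
  D : Matrix (Fin ny) (Fin nu) ℝ
  E : Matrix (Fin nz) (Fin nx) ℝ
  F : Matrix (Fin nz) (Fin nu) ℝ
  Gx : Matrix (Fin nx) (Fin nz) ℝ
  Gu : Matrix (Fin nu) (Fin nz) ℝ
  Gz : Matrix (Fin nz) (Fin nz) ℝ
  Y : Matrix (Fin m) (Fin ny) ℝ
  h : Fin m → ℝ
  ε : ℝ
  Q : Matrix (Fin nx) (Fin nx) ℝ
  R : Matrix (Fin nu) (Fin nu) ℝ
  P : Matrix (Fin nx) (Fin nx) ℝ
  r : Fin nz → ℝ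

namespace Setup

variable {nx nu ny nz m : ℕ} (S : Setup nx nu ny nz m)

/-- The matrix `Z` whose kernel consists of the equilibria `(x, u, z)`. -/
def Z : Matrix (Fin nx ⊕ Fin nz) (Fin nx ⊕ (Fin nu ⊕ Fin nz)) ℝ :=
  Matrix.fromRows
    (Matrix.fromCols (S.A - 1) (Matrix.fromCols S.B 0))
    (Matrix.fromCols S.E (Matrix.fromCols S.F (-1)))

/-- The stacked matrix `G = [Gx; Gu; Gz]`. -/
def G : Matrix (Fin nx ⊕ (Fin nu ⊕ Fin nz)) (Fin nz) ℝ :=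
  Matrix.fromRows S.Gx (Matrix.fromRows S.Gu S.Gz)

/-- The columns of `G` form a basis of `ker Z`. -/
def IsEquilibriumBasis : Prop :=
  LinearIndependent ℝ (fun j i => S.G i j) ∧
    Submodule.span ℝ (Set.range (fun j i => S.G i j)) = LinearMap.ker S.Z.mulVecLin

/-- The equilibrium state `x̄_v`. -/
def xbar (v : Fin nz → ℝ) : Fin nx → ℝ := S.Gx *ᵥ v

/-- The equilibrium input `ū_v`. -/
def ubar (v : Fin nz → ℝ) : Fin nu → ℝ := S.Gu *ᵥ v

/-- The constraint set `{y | Y y ≤ h}`. -/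
def constraintSet : Set (Fin ny → ℝ) := {y | S.Y *ᵥ y ≤ S.h}

/-- The strictly steady-state admissible references `R_ε`. -/
def admissibleRefs : Set (Fin nz → ℝ) :=
  {v | (S.C * S.Gx + S.D * S.Gu) *ᵥ v ∈ (1 - S.ε) • S.constraintSet}

/-- The best admissible approximation `r⋆` of `r`. -/
def rStar : Fin nz → ℝ := argmin (fun v => enorm2 (v - S.r)) S.admissibleRefs

/-- `P` solves the discrete algebraic Riccati equation. -/
def SolvesDARE : Prop :=
  S.P = S.Q + S.Aᵀ * S.P * S.A
    - (S.Aᵀ * S.P * S.B) * (S.R + S.Bᵀ * S.P * S.B)⁻¹ * (S.Bᵀ * S.P * S.A)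

/-- The LQR gain. -/
def K : Matrix (Fin nu) (Fin nx) ℝ :=
  (S.R + S.Bᵀ * S.P * S.B)⁻¹ * (S.Bᵀ * S.P * S.A)

/-- The LQR tracking law `u = ū_v - K (x - x̄_v)` for a constant reference `v`. -/
def lqrInput (v : Fin nz → ℝ) (x : Fin nx → ℝ) : Fin nu → ℝ :=
  S.ubar v - S.K *ᵥ (x - S.xbar v)

/-- The state trajectory from `x` under the LQR tracking law with constant reference `v`. -/
def lqrState (x : Fin nx → ℝ) (v : Fin nz → ℝ) : ℕ → Fin nx → ℝ
  | 0 => x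
  | j + 1 => S.A *ᵥ lqrState x v j + S.B *ᵥ S.lqrInput v (lqrState x v j)

/-- The terminal set: the maximal output admissible set of the LQR loop with constant reference,
with the steady-state output tightened by the factor `1 - ε`. -/
def terminalSet : Set ((Fin nx → ℝ) × (Fin nz → ℝ)) :=
  {p | S.C *ᵥ S.xbar p.2 + S.D *ᵥ S.ubar p.2 ∈ (1 - S.ε) • S.constraintSet ∧
    ∀ j : ℕ, S.C *ᵥ S.lqrState p.1 p.2 j + S.D *ᵥ S.lqrInput p.2 (S.lqrState p.1 p.2 j)
      ∈ S.constraintSet}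

variable {N : ℕ}

/-- The predicted states `ξ_0, …, ξ_N` from `x` under the input sequence `μ`. -/
def predState (x : Fin nx → ℝ) (μ : Fin N → Fin nu → ℝ) : Fin (N + 1) → Fin nx → ℝ :=
  Fin.induction x (fun i ξ => S.A *ᵥ ξ + S.B *ᵥ μ i)

/-- The input sequences that are feasible for the optimal control problem at `(x, v)`. -/
def ocpFeasible (N : ℕ) (x : Fin nx → ℝ) (v : Fin nz → ℝ) : Set (Fin N → Fin nu → ℝ) :=
  {μ | (∀ i : Fin N, S.C *ᵥ S.predState x μ i.castSucc + S.D *ᵥ μ i ∈ S.constraintSet) ∧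
    (S.predState x μ (Fin.last N), v) ∈ S.terminalSet}

/-- The cost of the optimal control problem at `(x, v)`. -/
def ocpCost (x : Fin nx → ℝ) (v : Fin nz → ℝ) (μ : Fin N → Fin nu → ℝ) : ℝ :=
  wsq S.P (S.predState x μ (Fin.last N) - S.xbar v) +
    ∑ i : Fin N, (wsq S.Q (S.predState x μ i.castSucc - S.xbar v) + wsq S.R (μ i - S.ubar v))

/-- The feasible set `Γ_N` of the optimal control problem. -/
def Gam (N : ℕ) : Set ((Fin nx → ℝ) × (Fin nz → ℝ)) :=
  {p | (S.ocpFeasible N p.1 p.2).Nonempty}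

/-- The MPC feedback policy `κ(x, v)`: the first input of the minimizer. -/
def mpc (N : ℕ) [NeZero N] (x : Fin nx → ℝ) (v : Fin nz → ℝ) : Fin nu → ℝ :=
  argmin (S.ocpCost x v) (S.ocpFeasible N x v) 0

/-- The MPC closed loop `f(x, v) = A x + B κ(x, v)`. -/
def step (N : ℕ) [NeZero N] (x : Fin nx → ℝ) (v : Fin nz → ℝ) : Fin nx → ℝ :=
  S.A *ᵥ x + S.B *ᵥ S.mpc N x v

/-- The references among which the feasibility governor chooses at the state `x`. -/
def govFeasible (N : ℕ) (x : Fin nx → ℝ) : Set (Fin nz → ℝ) :=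
  {v | v ∈ S.admissibleRefs ∧ (x, v) ∈ S.Gam N}

/-- The objective of the feasibility governor. -/
def govCost (v : Fin nz → ℝ) : ℝ := enorm2 (v - S.r) ^ 2

/-- The feasibility governor `g(x, r)`. -/
def gov (N : ℕ) (x : Fin nx → ℝ) : Fin nz → ℝ := argmin S.govCost (S.govFeasible N x)

/-- The feasible set `Λ = Γ_N ∩ (ℝⁿ × R_ε)` of the feasibility governor. -/
def Lam (N : ℕ) : Set ((Fin nx → ℝ) × (Fin nz → ℝ)) :=
  S.Gam N ∩ (Set.univ ×ˢ S.admissibleRefs)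

/-- The closed-loop states `x_{k+1} = f(x_k, g(x_k, r))`. -/
def stateSeq (N : ℕ) [NeZero N] (x₀ : Fin nx → ℝ) : ℕ → Fin nx → ℝ
  | 0 => x₀
  | k + 1 => S.step N (stateSeq N x₀ k) (S.gov N (stateSeq N x₀ k))

/-- The auxiliary references `v_k = g(x_k, r)` along the closed loop. -/
def refSeq (N : ℕ) [NeZero N] (x₀ : Fin nx → ℝ) (k : ℕ) : Fin nz → ℝ :=
  S.gov N (S.stateSeq N x₀ k)

end Setup

end FeasGov

end

/-! Two monotone quantities are played against each other. The shifted optimal input sequence,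
completed by the LQR law, is feasible at the next state (`shift_mem_ocpFeasible`), so v_k is still a
candidate when v_{k+1} is chosen. Hence ‖v_k − r‖² never increases, and since v_{k+1} minimizes it
over a convex set containing v_k, its drop is at least ‖v_{k+1} − v_k‖² (`govCost_gain`).

For the plant, `exists_lyapunov` gives W ≥ 0 that falls by κ‖x − x̄_v‖² per step, up to an error
c‖v' − v‖² caused by the change of reference. Adding c‖v − r‖² to W absorbs the error, so the sum
drops by a fixed amount whenever ‖x − x̄_v‖ > ρ. This cannot go on forever, so at some time x is
ρ-close to x̄_v. There the margin ε puts (x, w) in the terminal set for all admissible w near v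
(`exists_terminal_radius`). Thus v is a local, hence by convexity global, minimizer over R_ε, i.e. v
= r⋆ (`exists_radius_eq_rStar`); from then on r⋆ remains feasible and is chosen again.

Two ingredients support W. Detectability supplies a storage function, since the stage cost alone may
vanish away from equilibrium (`exists_storage_norm`). Polyhedrality controls the optimal value under
a change of reference: the terminal set is determined by finitely many constraints
(`isPolyhedron_terminalSet`), and a quantitative Fourier-Motzkin elimination shows that the feasible
input sets vary in a Lipschitz way (`projection_of_finiteDimensional`). The same elimination makes
the governor's feasible set closed. -/

noncomputable section

namespace FeasGov

/-! ### Semidefinite quadratic forms and their minimization over convex sets -/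

/-- A positive semidefinite quadratic form on a real vector space. -/
def IsNonnegQuadratic {E : Type*} [AddCommGroup E] [Module ℝ E] (q : E → ℝ) : Prop :=
  (∃ B : E →ₗ[ℝ] E →ₗ[ℝ] ℝ, ∀ x, q x = B x x) ∧ ∀ x, 0 ≤ q x

namespace IsNonnegQuadratic

section Algebra

variable {E F : Type*} [AddCommGroup E] [Module ℝ E] [AddCommGroup F] [Module ℝ F]
  {q q' : E → ℝ}

lemma nonneg (hq : IsNonnegQuadratic q) (x : E) : 0 ≤ q x := hq.2 x

lemma comp (hq : IsNonnegQuadratic q) (f : F →ₗ[ℝ] E) :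
    IsNonnegQuadratic (fun x => q (f x)) := by
  obtain ⟨⟨B, hB⟩, h0⟩ := hq
  exact ⟨⟨B.compl₁₂ f f, fun x => by simp [hB]⟩, fun x => h0 _⟩

lemma add (hq : IsNonnegQuadratic q) (hq' : IsNonnegQuadratic q') :
    IsNonnegQuadratic (fun x => q x + q' x) := by
  obtain ⟨⟨B, hB⟩, h0⟩ := hq
  obtain ⟨⟨B', hB'⟩, h0'⟩ := hq'
  exact ⟨⟨B + B', fun x => by simp [hB, hB']⟩, fun x => add_nonneg (h0 _) (h0' _)⟩

lemma sum {ι : Type*} [Fintype ι] {q : ι → E → ℝ} (hq : ∀ i, IsNonnegQuadratic (q i)) :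
    IsNonnegQuadratic (fun x => ∑ i, q i x) := by
  choose h h0 using hq
  choose B hB using h
  exact ⟨⟨∑ i, B i, fun x => by simp [hB]⟩, fun x => Finset.sum_nonneg fun i _ => h0 i x⟩

lemma map_neg (hq : IsNonnegQuadratic q) (x : E) : q (-x) = q x := by
  obtain ⟨⟨B, hB⟩, -⟩ := hq
  simp [hB]

lemma map_zero (hq : IsNonnegQuadratic q) : q 0 = 0 := by
  obtain ⟨⟨B, hB⟩, -⟩ := hq
  simp [hB]

/-- Young's inequality: expand 0 ≤ q (η x − y) and divide by η. A small η keeps the factor on q x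
near 1, which the Lyapunov argument needs. -/
lemma add_le (hq : IsNonnegQuadratic q) {η : ℝ} (hη : 0 < η) (x y : E) :
    q (x + y) ≤ (1 + η) * q x + (1 + η⁻¹) * q y := by
  obtain ⟨⟨B, hB⟩, h0⟩ := hq
  have h := h0 (η • x - y)
  simp only [hB, map_add, map_sub, LinearMap.add_apply, LinearMap.sub_apply, map_smul,
    LinearMap.smul_apply, smul_eq_mul] at h ⊢
  have h2 : 0 ≤ η⁻¹ * (η * (η * B x x) - B x y * η - (η * B y x - B y y)) := by
    refine mul_nonneg (by positivity) ?_
    linarith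
  have h3 : η⁻¹ * (η * (η * B x x) - B x y * η - (η * B y x - B y y))
      = η * B x x - B x y - B y x + η⁻¹ * B y y := by
    field_simp
    ring
  rw [h3] at h2
  linarith

lemma lineMap (hq : IsNonnegQuadratic q) (x y : E) (s : ℝ) :
    q (x + s • (y - x)) = (1 - s) * q x + s * q y - s * (1 - s) * q (y - x) := by
  obtain ⟨⟨B, hB⟩, -⟩ := hq
  simp only [hB, map_add, map_sub, LinearMap.add_apply, LinearMap.sub_apply, map_smul,
    LinearMap.smul_apply, smul_eq_mul]
  ring

/-- A minimizer `a` of a quadratic function over a convex set satisfies a variational inequality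
with quadratic gain. -/
lemma minimizer_gain {V : Type*} [AddCommGroup V] [Module ℝ V] (hq : IsNonnegQuadratic q)
    (l : V →ₗ[ℝ] E) (p : E) {s : Set V} (hs : Convex ℝ s) {a b : V}
    (ha : IsMinimizer (fun v => q (p + l v)) s a) (hb : b ∈ s) :
    q (l (b - a)) ≤ q (p + l b) - q (p + l a) := by
  have key : ∀ t ∈ Set.Ioc (0 : ℝ) 1,
      (1 - t) * q (l (b - a)) ≤ q (p + l b) - q (p + l a) := by
    intro t ht
    have hmem : a + t • (b - a) ∈ s := hs.add_smul_sub_mem ha.1 hb ⟨ht.1.le, ht.2⟩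
    have h := ha.2 hmem
    have h2 := hq.lineMap (p + l a) (p + l b) t
    have h3 : p + l a + t • (p + l b - (p + l a)) = p + l (a + t • (b - a)) := by
      simp only [LinearMap.map_add, LinearMap.map_smul, LinearMap.map_sub, add_sub_add_left_eq_sub]
      abel
    have h4 : p + l b - (p + l a) = l (b - a) := by
      simp [LinearMap.map_sub]
    rw [h3, h4] at h2
    simp only [Set.mem_ofPred_eq, h2] at h
    have h5 : 0 ≤ t * (q (p + l b) - q (p + l a) - (1 - t) * q (l (b - a))) := by linarith
    have := nonneg_of_mul_nonneg_right h5 ht.1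
    linarith
  by_contra! hlt
  set Δ := q (p + l b) - q (p + l a) with hΔ
  set Q := q (l (b - a)) with hQ
  have hΔ0 : 0 ≤ Δ := by simpa using key 1 ⟨one_pos, le_rfl⟩
  have hQ0 : 0 < Q := hΔ0.trans_lt hlt
  -- In place of a limit t → 0: this t makes (1 − t) Q the midpoint of Q and Δ, which exceeds Δ.
  have h := key ((Q - Δ) / (2 * Q)) ⟨by apply div_pos <;> linarith, by
    rw [div_le_one (by linarith)]; linarith⟩
  have h2 : (1 - (Q - Δ) / (2 * Q)) * Q = (Q + Δ) / 2 := by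
    field_simp
    ring
  linarith

end Algebra

section Normed

variable {E V : Type*} [NormedAddCommGroup E] [NormedSpace ℝ E] [FiniteDimensional ℝ E]
  [NormedAddCommGroup V] [NormedSpace ℝ V] [FiniteDimensional ℝ V] {q : E → ℝ}

lemma exists_continuous_bilin (hq : IsNonnegQuadratic q) :
    ∃ B : E →L[ℝ] E →L[ℝ] ℝ, ∀ x, q x = B x x := by
  obtain ⟨⟨B, hB⟩, -⟩ := hq
  exact ⟨LinearMap.toContinuousLinearMap
    ((LinearMap.toContinuousLinearMap : (E →ₗ[ℝ] ℝ) ≃ₗ[ℝ] (E →L[ℝ] ℝ)).toLinearMap ∘ₗ B),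
    fun x => by simp [hB]⟩

lemma continuous (hq : IsNonnegQuadratic q) : Continuous q := by
  obtain ⟨B, hB⟩ := hq.exists_continuous_bilin
  rw [funext hB]
  fun_prop

lemma exists_le (hq : IsNonnegQuadratic q) : ∃ C, 0 < C ∧ ∀ x, q x ≤ C * ‖x‖ ^ 2 := by
  obtain ⟨B, hB⟩ := hq.exists_continuous_bilin
  refine ⟨‖B‖ + 1, by positivity, fun x => ?_⟩
  have h := (le_abs_self _).trans (B.le_opNorm₂ x x)
  rw [hB]
  nlinarith [sq_nonneg ‖x‖]

lemma exists_ge (hq : IsNonnegQuadratic q) (hpos : ∀ x, x ≠ 0 → 0 < q x) :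
    ∃ c, 0 < c ∧ ∀ x, c * ‖x‖ ^ 2 ≤ q x := by
  have hsmul : ∀ (t : ℝ) x, q (t • x) = t ^ 2 * q x := by
    obtain ⟨⟨B, hB⟩, -⟩ := hq
    intro t x
    simp [hB]
    ring
  rcases (Metric.sphere (0 : E) 1).eq_empty_or_nonempty with he | hne
  · refine ⟨1, one_pos, fun x => ?_⟩
    have hx : x = 0 := by
      by_contra hx
      have : (‖x‖⁻¹ • x) ∈ Metric.sphere (0 : E) 1 := by
        simp [norm_smul, inv_mul_cancel₀ (norm_ne_zero_iff.2 hx)]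
      rw [he] at this
      exact this
    simp [hx, hq.map_zero]
  · obtain ⟨y, hy, hmin⟩ := (isCompact_sphere (0 : E) 1).exists_isMinOn hne
      hq.continuous.continuousOn
    have hy0 : y ≠ 0 := by
      rintro rfl
      simp at hy
    refine ⟨q y, hpos y hy0, fun x => ?_⟩
    by_cases hx : x = 0
    · simp [hx, hq.map_zero]
    have hxn : ‖x‖ ≠ 0 := norm_ne_zero_iff.2 hx
    have h : q y ≤ q (‖x‖⁻¹ • x) := hmin (by simp [norm_smul, inv_mul_cancel₀ hxn])
    rw [hsmul] at h
    calc q y * ‖x‖ ^ 2 ≤ (‖x‖⁻¹ ^ 2 * q x) * ‖x‖ ^ 2 := by gcongr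
      _ = q x := by field_simp

/-- A quadratic function that is strictly convex has a unique minimizer over a nonempty closed
convex set. -/
lemma existsUnique_minimizer (hq : IsNonnegQuadratic q) (l : V →ₗ[ℝ] E)
    (hpos : ∀ v, v ≠ 0 → 0 < q (l v)) (p : E) {s : Set V} (hs : Convex ℝ s) (hsc : IsClosed s)
    (hne : s.Nonempty) : ∃! v, IsMinimizer (fun v => q (p + l v)) s v := by
  obtain ⟨c, hc, hcq⟩ := (hq.comp l).exists_ge hpos
  obtain ⟨v₀, hv₀⟩ := hne
  have hl : Continuous l := l.continuous_of_finiteDimensional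
  have hcont : Continuous fun v => q (p + l v) := hq.continuous.comp (by fun_prop)
  have hbdd : Bornology.IsBounded (s ∩ {v | q (p + l v) ≤ q (p + l v₀)}) := by
    rw [isBounded_iff_forall_norm_le]
    refine ⟨(2 * q (p + l v₀) + 2 * q p) / c + 1, fun v hv => ?_⟩
    -- Coercivity: q (l v) is bounded by the objective at v plus a constant, so sublevel sets are
    -- bounded.
    have h1 := hq.add_le one_pos (p + l v) (-p)
    rw [hq.map_neg] at h1
    have h2 : p + l v + -p = l v := by abel
    rw [h2] at h1
    have h3 := hcq v
    have h4 : q (p + l v) ≤ q (p + l v₀) := hv.2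
    have h5 : c * ‖v‖ ^ 2 ≤ 2 * q (p + l v₀) + 2 * q p := by norm_num at h1; linarith
    have h6 : ‖v‖ ^ 2 ≤ (2 * q (p + l v₀) + 2 * q p) / c := by
      rw [le_div_iff₀ hc]; linarith
    nlinarith [sq_nonneg (‖v‖ - 1), norm_nonneg v]
  have hcomp : IsCompact (s ∩ {v | q (p + l v) ≤ q (p + l v₀)}) :=
    Metric.isCompact_of_isClosed_isBounded
      (hsc.inter (isClosed_le hcont continuous_const)) hbdd
  obtain ⟨v, hv, hmin⟩ := hcomp.exists_isMinOn ⟨v₀, hv₀, le_refl (q (p + l v₀))⟩ hcont.continuousOn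
  have hvmin : IsMinimizer (fun v => q (p + l v)) s v := by
    refine ⟨hv.1, fun w hw => ?_⟩
    by_cases hw' : q (p + l w) ≤ q (p + l v₀)
    · exact hmin ⟨hw, hw'⟩
    · exact hv.2.trans (not_le.1 hw').le
  refine ⟨v, hvmin, fun w hw => ?_⟩
  by_contra hne
  have h1 := hq.minimizer_gain l p hs hvmin hw.1
  have h2 : q (p + l w) ≤ q (p + l v) := hw.2 hvmin.1
  have h3 := hpos (w - v) (sub_ne_zero.2 hne)
  linarith

end Normed

end IsNonnegQuadratic

lemma isNonnegQuadratic_wsq {n : ℕ} {M : Matrix (Fin n) (Fin n) ℝ} (hM : M.PosSemidef) :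
    IsNonnegQuadratic (wsq M) := by
  refine ⟨⟨Matrix.toLinearMap₂' ℝ M, fun x => ?_⟩, fun x => ?_⟩
  · rw [Matrix.toLinearMap₂'_apply']
    rfl
  · simpa [wsq] using hM.dotProduct_mulVec_nonneg x

lemma wsq_pos {n : ℕ} {M : Matrix (Fin n) (Fin n) ℝ} (hM : M.PosDef) {x : Fin n → ℝ}
    (hx : x ≠ 0) : 0 < wsq M x := by
  simpa [wsq] using hM.dotProduct_mulVec_pos hx

lemma enorm2_sq {n : ℕ} (x : Fin n → ℝ) : enorm2 x ^ 2 = wsq 1 x := by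
  rw [enorm2, EuclideanSpace.real_norm_sq_eq]
  simp [wsq, dotProduct, sq]

lemma argmin_isMinimizer {α : Type*} [Nonempty α] {f : α → ℝ} {s : Set α}
    (h : ∃ a, IsMinimizer f s a) : IsMinimizer f s (argmin f s) :=
  Classical.epsilon_spec h

/-! ### Polyhedra: projections and Lipschitz fibres -/

/-- A polyhedron: the solution set of finitely many linear inequalities. -/
def IsPolyhedron {E : Type*} [NormedAddCommGroup E] [NormedSpace ℝ E] (s : Set E) : Prop :=
  ∃ (ι : Type) (_ : Finite ι) (f : ι → E →L[ℝ] ℝ) (c : ι → ℝ), s = {x | ∀ i, f i x ≤ c i}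

namespace IsPolyhedron

variable {E F : Type*} [NormedAddCommGroup E] [NormedSpace ℝ E] [NormedAddCommGroup F]
  [NormedSpace ℝ F]

lemma preimage {s : Set E} (hs : IsPolyhedron s) (g : F →L[ℝ] E) : IsPolyhedron (g ⁻¹' s) := by
  obtain ⟨ι, _, f, c, rfl⟩ := hs
  exact ⟨ι, inferInstance, fun i => (f i).comp g, c, rfl⟩

lemma iInter {κ : Type} [Finite κ] {s : κ → Set E} (hs : ∀ k, IsPolyhedron (s k)) :
    IsPolyhedron (⋂ k, s k) := by
  choose ι hι f c h using hs
  refine ⟨Σ k, ι k, inferInstance, fun i => f i.1 i.2, fun i => c i.1 i.2, ?_⟩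
  ext x
  simp [h, Sigma.forall]

lemma inter {s t : Set E} (hs : IsPolyhedron s) (ht : IsPolyhedron t) :
    IsPolyhedron (s ∩ t) := by
  obtain ⟨ι, _, f, c, rfl⟩ := hs
  obtain ⟨κ, _, g, d, rfl⟩ := ht
  refine ⟨ι ⊕ κ, inferInstance, Sum.elim f g, Sum.elim c d, ?_⟩
  ext x
  simp [Sum.forall]

lemma isClosed {s : Set E} (hs : IsPolyhedron s) : IsClosed s := by
  obtain ⟨ι, _, f, c, rfl⟩ := hs
  simp only [Set.ofPred_forall]
  exact isClosed_iInter fun i => isClosed_le (f i).continuous continuous_const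

lemma convex {s : Set E} (hs : IsPolyhedron s) : Convex ℝ s := by
  obtain ⟨ι, _, f, c, rfl⟩ := hs
  simp only [Set.ofPred_forall]
  exact convex_iInter fun i => convex_halfSpace_le (f i).isLinear (c i)

end IsPolyhedron

/-- Every point of a fibre of `s` can be moved to any other nonempty fibre by a displacement
proportional to the displacement of the base point. -/
def HasLipschitzFibres {E F : Type*} [NormedAddCommGroup E] [NormedAddCommGroup F]
    (s : Set (E × F)) : Prop :=
  ∃ L, 0 ≤ L ∧ ∀ p t, (p, t) ∈ s → ∀ p' ∈ Prod.fst '' s,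
    ∃ t', (p', t') ∈ s ∧ ‖t' - t‖ ≤ L * ‖p' - p‖

lemma exists_between_of_finite {ι κ : Type*} [Finite ι] [Finite κ] (l : ι → ℝ) (u : κ → ℝ)
    (h : ∀ i j, l i ≤ u j) : ∃ t, (∀ i, l i ≤ t) ∧ ∀ j, t ≤ u j := by
  rcases isEmpty_or_nonempty ι with hι | hι
  · rcases isEmpty_or_nonempty κ with hκ | hκ
    · exact ⟨0, fun i => hι.elim i, fun j => hκ.elim j⟩
    · obtain ⟨j, hj⟩ := Finite.exists_min u
      exact ⟨u j, fun i => hι.elim i, hj⟩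
  · obtain ⟨i, hi⟩ := Finite.exists_max l
    exact ⟨l i, hi, h i⟩

namespace IsPolyhedron

variable {E : Type*} [NormedAddCommGroup E] [NormedSpace ℝ E]

/-- Fourier-Motzkin elimination of one variable. -/
lemma fst_image_real {s : Set (E × ℝ)} (hs : IsPolyhedron s) : IsPolyhedron (Prod.fst '' s) := by
  obtain ⟨ι, _, f, c, rfl⟩ := hs
  set a : ι → E →L[ℝ] ℝ := fun i => (f i).comp (ContinuousLinearMap.inl ℝ E ℝ) with ha
  set b : ι → ℝ := fun i => f i (0, 1) with hb
  have hf : ∀ i p t, f i (p, t) = a i p + b i * t := by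
    intro i p t
    have : ((p, t) : E × ℝ) = (p, 0) + t • (0, 1) := by simp
    rw [this, map_add, map_smul, smul_eq_mul, mul_comm]
    rfl
  have hZ : IsPolyhedron (⋂ i : {i // b i = 0}, {p | a i p ≤ c i}) := by
    refine iInter fun i => ⟨Unit, inferInstance, fun _ => a i, fun _ => c i, by simp⟩
  have hUL : IsPolyhedron (⋂ ij : {i // b i < 0} × {j // 0 < b j},
      {p | (b ij.1)⁻¹ * (c ij.1 - a ij.1 p) ≤ (b ij.2)⁻¹ * (c ij.2 - a ij.2 p)}) := by
    refine iInter fun ij => ⟨Unit, inferInstance,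
      fun _ => (b ij.2)⁻¹ • a ij.2 - (b ij.1)⁻¹ • a ij.1,
      fun _ => (b ij.2)⁻¹ * c ij.2 - (b ij.1)⁻¹ * c ij.1, ?_⟩
    ext p
    simp only [Set.mem_ofPred_eq, sub_apply, smul_apply,
      smul_eq_mul, forall_const, mul_sub]
    constructor <;> intro h <;> linarith
  have hpos : ∀ i, 0 < b i → ∀ p t, f i (p, t) ≤ c i ↔ t ≤ (b i)⁻¹ * (c i - a i p) := by
    intro i hi p t
    rw [hf, le_inv_mul_iff₀ hi]
    constructor <;> intro h <;> linarith
  have hneg : ∀ i, b i < 0 → ∀ p t, f i (p, t) ≤ c i ↔ (b i)⁻¹ * (c i - a i p) ≤ t := by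
    intro i hi p t
    rw [hf, inv_mul_eq_div, div_le_iff_of_neg hi]
    constructor <;> intro h <;> linarith
  convert hZ.inter hUL
  ext p
  simp only [Set.mem_image, Set.mem_ofPred_eq, Prod.exists, exists_and_right, exists_eq_right,
    Set.mem_inter_iff, Set.mem_iInter]
  constructor
  · rintro ⟨t, ht⟩
    refine ⟨fun i => ?_, fun ij => ?_⟩
    · have := ht i
      rw [hf, i.2] at this
      simpa using this
    · exact ((hneg _ ij.1.2 _ _).1 (ht _)).trans ((hpos _ ij.2.2 _ _).1 (ht _))
  · rintro ⟨h0, h1⟩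
    obtain ⟨t, htl, htu⟩ := exists_between_of_finite
      (fun i : {i // b i < 0} => (b i)⁻¹ * (c i - a i p))
      (fun j : {j // 0 < b j} => (b j)⁻¹ * (c j - a j p)) (fun i j => h1 (i, j))
    refine ⟨t, fun i => ?_⟩
    rcases lt_trichotomy (b i) 0 with hi | hi | hi
    · exact (hneg i hi p t).2 (htl ⟨i, hi⟩)
    · rw [hf, hi]
      simpa using h0 ⟨i, hi⟩
    · exact (hpos i hi p t).2 (htu ⟨i, hi⟩)

/-- The fibre over p is an interval whose bounds are maxima and minima of finitely many affine
functions of p, so each bound moves at a rate of at most max ‖a i‖ / |b i|; the sum L over all i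
dominates this. -/
lemma hasLipschitzFibres_real {s : Set (E × ℝ)} (hs : IsPolyhedron s) : HasLipschitzFibres s := by
  obtain ⟨ι, _, f, c, rfl⟩ := hs
  have := Fintype.ofFinite ι
  set a : ι → E →L[ℝ] ℝ := fun i => (f i).comp (ContinuousLinearMap.inl ℝ E ℝ) with ha
  set b : ι → ℝ := fun i => f i (0, 1) with hb
  have hf : ∀ i p t, f i (p, t) = a i p + b i * t := by
    intro i p t
    have : ((p, t) : E × ℝ) = (p, 0) + t • (0, 1) := by simp
    rw [this, map_add, map_smul, smul_eq_mul, mul_comm]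
    rfl
  set L : ℝ := ∑ i, |b i|⁻¹ * ‖a i‖ with hL
  have hL0 : 0 ≤ L := Finset.sum_nonneg fun i _ => by positivity
  have hLi : ∀ i, b i ≠ 0 → ∀ p p', a i p' - a i p ≤ |b i| * (L * ‖p' - p‖) := by
    intro i hi p p'
    have h1 : |b i|⁻¹ * ‖a i‖ ≤ L :=
      Finset.single_le_sum (f := fun i => |b i|⁻¹ * ‖a i‖) (fun i _ => by positivity)
        (Finset.mem_univ i)
    have h2 : 0 < |b i| := abs_pos.2 hi
    rw [inv_mul_le_iff₀ h2] at h1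
    calc a i p' - a i p = a i (p' - p) := by rw [map_sub]
      _ ≤ ‖a i‖ * ‖p' - p‖ := (le_abs_self _).trans ((a i).le_opNorm _)
      _ ≤ (|b i| * L) * ‖p' - p‖ := by gcongr
      _ = _ := by ring
  refine ⟨L, hL0, ?_⟩
  intro p t hpt p' hp'
  obtain ⟨⟨q, t₀⟩, hpt₀, hq⟩ := hp'
  obtain rfl : p' = q := hq.symm
  simp only [Set.mem_ofPred_eq, hf] at hpt hpt₀ ⊢
  set δ := L * ‖p' - p‖ with hδ
  have hδ0 : 0 ≤ δ := by positivity
  -- The known point t₀ of the new fibre, clamped to [t − δ, t + δ]. Each constraint bounds the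
  -- variable from one side; on that side the clamped value is no worse than t₀ or than t shifted by
  -- δ, and both satisfy the constraint.
  refine ⟨max (t - δ) (min t₀ (t + δ)), fun i => ?_, ?_⟩
  · rcases lt_trichotomy (b i) 0 with hi | hi | hi
    · have h := hLi i hi.ne p p'
      rw [abs_of_neg hi] at h
      rcases le_total t₀ (t + δ) with h1 | h1
      · have : t₀ ≤ max (t - δ) (min t₀ (t + δ)) := le_max_of_le_right (le_min le_rfl h1)
        nlinarith [hpt₀ i]
      · have : t + δ ≤ max (t - δ) (min t₀ (t + δ)) := le_max_of_le_right (le_min h1 le_rfl)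
        nlinarith [hpt i]
    · simpa [hi] using hpt₀ i
    · have h := hLi i hi.ne' p p'
      rw [abs_of_pos hi] at h
      rcases le_total t₀ (t - δ) with h1 | h1
      · have : max (t - δ) (min t₀ (t + δ)) ≤ t - δ :=
          max_le le_rfl ((min_le_left _ _).trans h1)
        nlinarith [hpt i]
      · have : max (t - δ) (min t₀ (t + δ)) ≤ t₀ := max_le h1 (min_le_left _ _)
        nlinarith [hpt₀ i]
  · rw [Real.norm_eq_abs, abs_le]
    constructor
    · linarith [le_max_left (t - δ) (min t₀ (t + δ))]
    · have : max (t - δ) (min t₀ (t + δ)) ≤ t + δ := max_le (by linarith) (min_le_right _ _)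
      linarith

/-- The projection of a polyhedron along finitely many coordinates is a polyhedron, and its fibres
vary in a Lipschitz way. -/
lemma projection (n : ℕ) : ∀ {s : Set (E × (Fin n → ℝ))}, IsPolyhedron s →
    IsPolyhedron (Prod.fst '' s) ∧ HasLipschitzFibres s := by
  induction n with
  | zero =>
    intro s hs
    constructor
    · convert hs.preimage (ContinuousLinearMap.inl ℝ E (Fin 0 → ℝ))
      ext p
      constructor
      · rintro ⟨⟨p, t⟩, h, rfl⟩
        rwa [Subsingleton.elim t 0] at h
      · exact fun h => ⟨_, h, rfl⟩
    · refine ⟨0, le_rfl, ?_⟩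
      rintro p t - p' ⟨⟨_, t'⟩, ht', rfl⟩
      exact ⟨t', ht', by simp [Subsingleton.elim t' t]⟩
  | succ n ih =>
    intro s hs
    set g : (E × (Fin n → ℝ)) × ℝ →L[ℝ] E × (Fin (n + 1) → ℝ) :=
      ((ContinuousLinearMap.fst ℝ E (Fin n → ℝ)).comp (ContinuousLinearMap.fst ℝ _ ℝ)).prod
        (ContinuousLinearMap.pi (Fin.cons (ContinuousLinearMap.snd ℝ _ ℝ)
          (fun i => (ContinuousLinearMap.proj i).comp
            ((ContinuousLinearMap.snd ℝ E (Fin n → ℝ)).comp (ContinuousLinearMap.fst ℝ _ ℝ))))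
          ) with hg
    have hgapp : ∀ p t r, g ((p, t), r) = (p, Fin.cons r t) := by
      intro p t r
      refine Prod.ext rfl (funext fun i => ?_)
      refine Fin.cases ?_ (fun i => ?_) i <;> simp [hg]
    have h1 := hs.preimage g
    obtain ⟨h2, L₂, hL₂, hlip₂⟩ := ih h1.fst_image_real
    obtain ⟨L₁, hL₁, hlip₁⟩ := h1.hasLipschitzFibres_real
    have himg : Prod.fst '' (Prod.fst '' (g ⁻¹' s)) = Prod.fst '' s := by
      ext p
      constructor
      · rintro ⟨_, ⟨⟨⟨p, t⟩, r⟩, h, rfl⟩, rfl⟩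
        exact ⟨_, h, by simp [hgapp]⟩
      · rintro ⟨⟨p, t⟩, h, rfl⟩
        refine ⟨(p, Fin.tail t), ⟨((p, Fin.tail t), t 0), ?_, rfl⟩, rfl⟩
        simpa [hgapp] using h
    -- Moving the first n coordinates costs L₂; the last one then follows a base point that has
    -- moved by at most (1 + L₂)‖p' − p‖.
    refine ⟨himg ▸ h2, L₂ + L₁ * (1 + L₂), by positivity, ?_⟩
    intro p t hpt p' hp'
    rw [← himg] at hp'
    have hm : ((p, Fin.tail t), t 0) ∈ g ⁻¹' s := by simpa [hgapp] using hpt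
    obtain ⟨t', ht', hlt'⟩ := hlip₂ p (Fin.tail t) ⟨_, hm, rfl⟩ p' hp'
    obtain ⟨r', hr', hlr'⟩ := hlip₁ _ _ hm _ ht'
    refine ⟨Fin.cons r' t', by simpa [hgapp] using hr', ?_⟩
    have hb : ‖((p', t') : E × (Fin n → ℝ)) - (p, Fin.tail t)‖ ≤ (1 + L₂) * ‖p' - p‖ := by
      rw [Prod.mk_sub_mk, Prod.norm_def]
      refine max_le ?_ ?_
      · nlinarith [norm_nonneg (p' - p)]
      · nlinarith [norm_nonneg (p' - p)]
    have hb' : ‖r' - t 0‖ ≤ L₁ * (1 + L₂) * ‖p' - p‖ := by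
      calc _ ≤ _ := hlr'
        _ ≤ L₁ * ((1 + L₂) * ‖p' - p‖) := by gcongr
        _ = _ := by ring
    rw [pi_norm_le_iff_of_nonneg (by positivity)]
    intro i
    refine Fin.cases ?_ (fun i => ?_) i
    · simp only [Pi.sub_apply, Fin.cons_zero]
      nlinarith [mul_nonneg hL₂ (norm_nonneg (p' - p))]
    · have h3 := (norm_le_pi_norm (t' - Fin.tail t) i).trans hlt'
      simp only [Pi.sub_apply, Fin.cons_succ, Fin.tail] at h3 ⊢
      have : 0 ≤ L₁ * (1 + L₂) * ‖p' - p‖ := by positivity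
      linarith

lemma projection_of_finiteDimensional {F : Type*} [NormedAddCommGroup F] [NormedSpace ℝ F]
    [FiniteDimensional ℝ F] {s : Set (E × F)} (hs : IsPolyhedron s) :
    IsPolyhedron (Prod.fst '' s) ∧ HasLipschitzFibres s := by
  obtain ⟨e⟩ : Nonempty (F ≃L[ℝ] (Fin (Module.finrank ℝ F) → ℝ)) :=
    ⟨ContinuousLinearEquiv.ofFinrankEq (by simp)⟩
  obtain ⟨i, hi⟩ : ∃ i : (Fin (Module.finrank ℝ F) → ℝ) →L[ℝ] F, ∀ t, i t = e.symm t :=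
    ⟨e.symm, fun _ => rfl⟩
  set g : E × (Fin (Module.finrank ℝ F) → ℝ) →L[ℝ] E × F :=
    (ContinuousLinearMap.fst ℝ _ _).prod (i.comp (ContinuousLinearMap.snd ℝ _ _)) with hg
  obtain ⟨h, L, hL, hlip⟩ := projection _ (hs.preimage g)
  have hgapp : ∀ p t, g (p, t) = (p, i t) := fun p t => rfl
  have hmem : ∀ p t, (p, t) ∈ s → (p, e t) ∈ g ⁻¹' s := by
    intro p t h
    simpa [hgapp, hi] using h
  have himg : Prod.fst '' (g ⁻¹' s) = Prod.fst '' s := by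
    ext p
    constructor
    · rintro ⟨⟨p, t⟩, h, rfl⟩
      exact ⟨_, h, rfl⟩
    · rintro ⟨⟨p, t⟩, h, rfl⟩
      exact ⟨(p, e t), hmem p t h, rfl⟩
  refine ⟨himg ▸ h, ‖i‖ * L, by positivity, ?_⟩
  intro p t hpt p' hp'
  rw [← himg] at hp'
  obtain ⟨t', ht', hlt⟩ := hlip p (e t) (hmem p t hpt) p' hp'
  refine ⟨i t', ht', ?_⟩
  have h1 : i t' - t = i (t' - e t) := by simp [hi]
  rw [h1, mul_assoc]
  exact (i.le_opNorm _).trans (by gcongr)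

end IsPolyhedron

/-! ### Schur matrices, and storage functions from detectability -/

section Schur

attribute [local instance] Matrix.linftyOpNormedRing Matrix.linftyOpNormedAlgebra

/-- Gelfand's formula over ℂ; passing from M to its complexification does not change the ℓ∞ operator
norm. -/
lemma IsSchur.exists_pow_contracting {n : ℕ} {M : Matrix (Fin n) (Fin n) ℝ} (hM : IsSchur M) :
    ∃ k : ℕ, ∀ x : Fin n → ℝ, ‖(M ^ k) *ᵥ x‖ ≤ 1 / 2 * ‖x‖ := by
  set A : Matrix (Fin n) (Fin n) ℂ := M.map (algebraMap ℝ ℂ) with hA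
  have : CompleteSpace (Matrix (Fin n) (Fin n) ℂ) := FiniteDimensional.complete ℂ _
  have hrad : spectralRadius ℂ A < 1 := by
    rcases (spectrum ℂ A).eq_empty_or_nonempty with he | hne
    · simp [spectralRadius, he]
    · refine spectrum.spectralRadius_lt_of_forall_lt_of_nonempty hne (r := 1) fun z hz => ?_
      exact_mod_cast hM z hz
  obtain ⟨r, hr0, hr1⟩ := exists_between hrad
  have hlim := spectrum.pow_nnnorm_pow_one_div_tendsto_nhds_spectralRadius A
  have h1 := hlim.eventually_lt_const hr0
  have h2 : Filter.Tendsto (fun k : ℕ => r ^ k) Filter.atTop (nhds 0) :=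
    ENNReal.tendsto_pow_atTop_nhds_zero_of_lt_one hr1
  have h3 := h2.eventually_lt_const (show (0 : ENNReal) < ((1 / 2 : NNReal) : ENNReal) by simp)
  obtain ⟨k, ⟨hk1, hk2⟩, hk0⟩ := ((h1.and h3).and (Filter.eventually_gt_atTop 0)).exists
  refine ⟨k, fun x => ?_⟩
  have h4 : (‖A ^ k‖₊ : ENNReal) < ((1 / 2 : NNReal) : ENNReal) := by
    refine lt_of_le_of_lt ?_ hk2
    have := ENNReal.rpow_le_rpow hk1.le (show (0 : ℝ) ≤ k by positivity)
    rw [← ENNReal.rpow_mul, one_div, inv_mul_cancel₀ (by positivity), ENNReal.rpow_one,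
      ENNReal.rpow_natCast] at this
    exact this
  have h5 : ‖A ^ k‖₊ = ‖M ^ k‖₊ := by
    have : A ^ k = (M ^ k).map (algebraMap ℝ ℂ) := by
      simpa [hA] using (map_pow (algebraMap ℝ ℂ).mapMatrix M k).symm
    rw [this, Matrix.linfty_opNNNorm_def, Matrix.linfty_opNNNorm_def]
    simp
  rw [h5, ENNReal.coe_lt_coe] at h4
  have h6 : ‖M ^ k‖ ≤ 1 / 2 := by exact_mod_cast h4.le
  exact (Matrix.linfty_opNorm_mulVec _ _).trans (by gcongr)

end Schur

lemma exists_norm_mulVec_le {n m : ℕ} (M : Matrix (Fin m) (Fin n) ℝ) :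
    ∃ C, 0 < C ∧ ∀ x : Fin n → ℝ, ‖M *ᵥ x‖ ≤ C * ‖x‖ := by
  refine ⟨‖LinearMap.toContinuousLinearMap M.mulVecLin‖ + 1, by positivity, fun x => ?_⟩
  refine ((LinearMap.toContinuousLinearMap M.mulVecLin).le_opNorm x).trans ?_
  gcongr
  linarith

/-- A Schur matrix contracts some norm. -/
lemma IsSchur.exists_contracted_norm {n : ℕ} {M : Matrix (Fin n) (Fin n) ℝ} (hM : IsSchur M) :
    ∃ (a : (Fin n → ℝ) → ℝ) (C γ : ℝ), 0 < C ∧ 0 ≤ γ ∧ γ < 1 ∧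
      (∀ x y, a (x + y) ≤ a x + a y) ∧ (∀ x, ‖x‖ ≤ a x) ∧ (∀ x, a x ≤ C * ‖x‖) ∧
      ∀ x, a (M *ᵥ x) ≤ γ * a x := by
  obtain ⟨k, hk⟩ := hM.exists_pow_contracting
  choose C hC0 hC using fun i : ℕ => exists_norm_mulVec_le (M ^ i)
  have hC0' : 0 ≤ ∑ i ∈ Finset.range k, C i := Finset.sum_nonneg fun i _ => (hC0 i).le
  set D := ∑ i ∈ Finset.range k, C i + 1 with hD
  have hD1 : 1 ≤ D := by linarith
  set s : (Fin n → ℝ) → ℝ := fun x => ∑ i ∈ Finset.range k, ‖(M ^ i) *ᵥ x‖ with hs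
  have hle : ∀ x, 2 * s x + ‖x‖ ≤ 2 * D * ‖x‖ := by
    intro x
    have : s x ≤ (D - 1) * ‖x‖ := by
      rw [hD, add_sub_cancel_right, Finset.sum_mul]
      exact Finset.sum_le_sum fun i _ => hC i x
    linarith [norm_nonneg x]
  have hs0 : ∀ x, 0 ≤ s x := fun x => Finset.sum_nonneg fun i _ => norm_nonneg _
  -- Telescoping: with the contraction of M ^ k, s drops by at least ‖x‖ / 2 along M, and ‖x‖ is
  -- comparable to s x.
  have hstep : ∀ x, s (M *ᵥ x) + ‖x‖ = s x + ‖(M ^ k) *ᵥ x‖ := by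
    intro x
    have h1 := Finset.sum_range_succ (fun i => ‖(M ^ i) *ᵥ x‖) k
    have h2 := Finset.sum_range_succ' (fun i => ‖(M ^ i) *ᵥ x‖) k
    simp only [pow_succ, pow_zero, Matrix.one_mulVec, ← Matrix.mulVec_mulVec] at h2
    rw [h1] at h2
    exact h2.symm
  have hxs : ∀ x, ‖x‖ ≤ 2 * s x := by
    intro x
    linarith [hs0 (M *ᵥ x), hstep x, hk x, norm_nonneg x]
  refine ⟨fun x => 2 * s x, 2 * D, 1 - 1 / (2 * D), by linarith, ?_, ?_, ?_, hxs, ?_, ?_⟩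
  · rw [sub_nonneg, div_le_one (by linarith)]
    linarith
  · have : 0 < 1 / (2 * D) := by positivity
    linarith
  · intro x y
    have : s (x + y) ≤ s x + s y := by
      simp only [hs, ← Finset.sum_add_distrib]
      refine Finset.sum_le_sum fun i _ => ?_
      rw [Matrix.mulVec_add]
      exact norm_add_le _ _
    linarith
  · intro x
    linarith [hle x, norm_nonneg x]
  · intro x
    have h1 : 1 / (2 * D) * (2 * s x) ≤ ‖x‖ := by
      rw [one_div, inv_mul_le_iff₀ (by linarith)]
      linarith [hle x, norm_nonneg x]
    linarith [hstep x, hk x]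

/-- Links the sup norm of the function space to the Euclidean form `wsq 1` of the governor. -/
lemma norm_sq_le_dotProduct {n : ℕ} (x : Fin n → ℝ) : ‖x‖ ^ 2 ≤ x ⬝ᵥ x := by
  have h0 : 0 ≤ x ⬝ᵥ x := by simpa using dotProduct_star_self_nonneg x
  rw [← Real.le_sqrt (norm_nonneg _) h0, pi_norm_le_iff_of_nonneg (Real.sqrt_nonneg _)]
  intro i
  rw [Real.le_sqrt (norm_nonneg _) h0, Real.norm_eq_abs, sq_abs, sq]
  exact Finset.single_le_sum (f := fun i => x i * x i) (fun i _ => mul_self_nonneg _)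
    (Finset.mem_univ i)

open scoped MatrixOrder Matrix.Norms.L2Operator in
lemma exists_eq_transpose_mul_self {n : ℕ} {Q : Matrix (Fin n) (Fin n) ℝ}
    (hQ : Q.PosSemidef) : ∃ T : Matrix (Fin n) (Fin n) ℝ, Q = Tᵀ * T := by
  obtain ⟨T, hT⟩ := CStarAlgebra.nonneg_iff_eq_star_mul_self.mp hQ.nonneg
  exact ⟨T, by rw [hT, Matrix.star_eq_conjTranspose, Matrix.conjTranspose_eq_transpose_of_trivial]⟩

/-- With Q = TᵀT the form is |T x|² and Q x = Tᵀ(T x). So the output Q x in the detectability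
hypothesis is controlled by the stage cost. -/
lemma exists_norm_mulVec_sq_le_wsq {n : ℕ} {Q : Matrix (Fin n) (Fin n) ℝ} (hQ : Q.PosSemidef) :
    ∃ C, 0 < C ∧ ∀ x, ‖Q *ᵥ x‖ ^ 2 ≤ C * wsq Q x := by
  obtain ⟨T, hT⟩ := exists_eq_transpose_mul_self hQ
  obtain ⟨C, hC, hCle⟩ := exists_norm_mulVec_le Tᵀ
  refine ⟨C ^ 2, by positivity, fun x => ?_⟩
  have h1 : wsq Q x = (T *ᵥ x) ⬝ᵥ (T *ᵥ x) := by
    rw [wsq, hT, ← Matrix.mulVec_mulVec, Matrix.dotProduct_mulVec, Matrix.vecMul_transpose]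
  have h2 : ‖Q *ᵥ x‖ ≤ C * ‖T *ᵥ x‖ := by
    rw [hT, ← Matrix.mulVec_mulVec]
    exact hCle _
  calc ‖Q *ᵥ x‖ ^ 2 ≤ (C * ‖T *ᵥ x‖) ^ 2 := by gcongr
    _ = C ^ 2 * ‖T *ᵥ x‖ ^ 2 := by ring
    _ ≤ C ^ 2 * wsq Q x := by
      rw [h1]
      gcongr
      exact norm_sq_le_dotProduct _

/-- Detectability yields a norm whose square is a storage function for the stage cost. -/
lemma exists_storage_norm {n p : ℕ} {A Q : Matrix (Fin n) (Fin n) ℝ}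
    (B : Matrix (Fin n) (Fin p) ℝ) {R : Matrix (Fin p) (Fin p) ℝ} (hQ : Q.PosSemidef)
    (hdet : IsDetectable A Q) (hR : R.PosDef) :
    ∃ (a : (Fin n → ℝ) → ℝ) (C γ : ℝ), 0 < C ∧ 0 ≤ γ ∧ γ < 1 ∧
      (∀ x y, a (x + y) ≤ a x + a y) ∧ (∀ x, ‖x‖ ≤ a x) ∧ (∀ x, a x ≤ C * ‖x‖) ∧
      ∀ x w, a (A *ᵥ x + B *ᵥ w) ^ 2 ≤ γ * a x ^ 2 + C * (wsq Q x + wsq R w) := by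
  obtain ⟨L, hL⟩ := hdet
  obtain ⟨a, C, γ, hC, hγ0, hγ1, hadd, hge, hle, hcon⟩ := hL.exists_contracted_norm
  obtain ⟨c₁, hc₁, hL⟩ := exists_norm_mulVec_le L
  obtain ⟨c₂, hc₂, hB⟩ := exists_norm_mulVec_le B
  obtain ⟨c₃, hc₃, hQ'⟩ := exists_norm_mulVec_sq_le_wsq hQ
  obtain ⟨c₄, hc₄, hR'⟩ :=
    (isNonnegQuadratic_wsq hR.posSemidef).exists_ge fun x hx => wsq_pos hR hx
  have ha0 : ∀ x, 0 ≤ a x := fun x => (norm_nonneg x).trans (hge x)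
  set D := 2 * c₁ ^ 2 * c₃ + 2 * c₂ ^ 2 / c₄ with hD
  have hD0 : 0 < D := by positivity
  have hy : ∀ x w, ‖L *ᵥ (Q *ᵥ x) + B *ᵥ w‖ ^ 2 ≤ D * (wsq Q x + wsq R w) := by
    intro x w
    have h1 : ‖L *ᵥ (Q *ᵥ x) + B *ᵥ w‖ ≤ c₁ * ‖Q *ᵥ x‖ + c₂ * ‖w‖ :=
      (norm_add_le _ _).trans (add_le_add (hL _) (hB _))
    have h2 : ‖w‖ ^ 2 ≤ wsq R w / c₄ := by
      rw [le_div_iff₀ hc₄]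
      linarith [hR' w]
    have hq0 := (isNonnegQuadratic_wsq hQ).nonneg x
    have hr0 := (isNonnegQuadratic_wsq hR.posSemidef).nonneg w
    calc ‖L *ᵥ (Q *ᵥ x) + B *ᵥ w‖ ^ 2 ≤ (c₁ * ‖Q *ᵥ x‖ + c₂ * ‖w‖) ^ 2 := by gcongr
      _ ≤ 2 * c₁ ^ 2 * ‖Q *ᵥ x‖ ^ 2 + 2 * c₂ ^ 2 * ‖w‖ ^ 2 := by
        nlinarith [sq_nonneg (c₁ * ‖Q *ᵥ x‖ - c₂ * ‖w‖)]
      _ ≤ 2 * c₁ ^ 2 * (c₃ * wsq Q x) + 2 * c₂ ^ 2 * (wsq R w / c₄) := by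
        gcongr
        exact hQ' x
      _ = 2 * c₁ ^ 2 * c₃ * wsq Q x + 2 * c₂ ^ 2 / c₄ * wsq R w := by ring
      _ ≤ D * wsq Q x + D * wsq R w := by
        have : 0 ≤ 2 * c₁ ^ 2 * c₃ := by positivity
        have : 0 ≤ 2 * c₂ ^ 2 / c₄ := by positivity
        gcongr <;> linarith
      _ = _ := by ring
  have h1γ : 0 < 1 - γ := by linarith
  refine ⟨a, C + C ^ 2 * D / (1 - γ), γ, by positivity, hγ0, hγ1, hadd, hge, fun x => ?_,
    fun x w => ?_⟩
  · refine (hle x).trans ?_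
    gcongr
    have : 0 ≤ C ^ 2 * D / (1 - γ) := by positivity
    linarith
  · set y := ‖L *ᵥ (Q *ᵥ x) + B *ᵥ w‖ with hydef
    have hl0 : 0 ≤ wsq Q x + wsq R w :=
      add_nonneg ((isNonnegQuadratic_wsq hQ).nonneg x)
        ((isNonnegQuadratic_wsq hR.posSemidef).nonneg w)
    -- Output injection: a contracted part plus a term whose square is bounded by the stage cost.
    have hdecomp : A *ᵥ x + B *ᵥ w
        = (A - L * Q) *ᵥ x + (L *ᵥ (Q *ᵥ x) + B *ᵥ w) := by
      rw [Matrix.sub_mulVec, Matrix.mulVec_mulVec]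
      abel
    have h1 : a (A *ᵥ x + B *ᵥ w) ≤ γ * a x + C * y := by
      rw [hdecomp]
      exact (hadd _ _).trans (add_le_add (hcon x) (hle _))
    -- Convexity of the square, with weights γ and 1 − γ on a x and C y / (1 − γ).
    have h2 : (γ * a x + C * y) ^ 2 ≤ γ * a x ^ 2 + (C * y) ^ 2 / (1 - γ) := by
      have : γ * a x ^ 2 + (C * y) ^ 2 / (1 - γ) - (γ * a x + C * y) ^ 2
          = γ * ((1 - γ) * a x - C * y) ^ 2 / (1 - γ) := by
        field_simp
        ring
      have h0 : 0 ≤ γ * ((1 - γ) * a x - C * y) ^ 2 / (1 - γ) := by positivity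
      linarith
    calc a (A *ᵥ x + B *ᵥ w) ^ 2 ≤ (γ * a x + C * y) ^ 2 := by
          gcongr
          exact ha0 _
      _ ≤ γ * a x ^ 2 + (C * y) ^ 2 / (1 - γ) := h2
      _ = γ * a x ^ 2 + C ^ 2 / (1 - γ) * y ^ 2 := by ring
      _ ≤ γ * a x ^ 2 + C ^ 2 / (1 - γ) * (D * (wsq Q x + wsq R w)) := by
        gcongr
        exact hy x w
      _ = γ * a x ^ 2 + (C ^ 2 * D / (1 - γ)) * (wsq Q x + wsq R w) := by ring
      _ ≤ _ := by
        gcongr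
        linarith

/-! ### The LQR loop -/

namespace Setup

variable {nx nu ny nz m : ℕ} (S : Setup nx nu ny nz m)

/-- The closed-loop matrix under the LQR gain. -/
def Acl : Matrix (Fin nx) (Fin nx) ℝ := S.A - S.B * S.K

variable {S}

/-- The terminal cost decreases by exactly the stage cost along the LQR loop. -/
lemma wsq_lqr (hR : S.R.PosDef) (hP : S.P.PosSemidef) (hDARE : S.SolvesDARE) (x : Fin nx → ℝ) :
    wsq S.P (S.A *ᵥ x + S.B *ᵥ (-(S.K *ᵥ x))) + (wsq S.Q x + wsq S.R (-(S.K *ᵥ x)))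
      = wsq S.P x := by
  have hT : (S.R + S.Bᵀ * S.P * S.B).PosDef :=
    hR.add_posSemidef (by simpa using hP.conjTranspose_mul_mul_same S.B)
  have hdet : IsUnit (S.R + S.Bᵀ * S.P * S.B).det := hT.det_pos.ne'.isUnit
  have hK : (S.R + S.Bᵀ * S.P * S.B) * S.K = S.Bᵀ * S.P * S.A := by
    rw [K, ← Matrix.mul_assoc, Matrix.mul_nonsing_inv _ hdet, Matrix.one_mul]
  have hD : S.P = S.Q + S.Aᵀ * S.P * S.A - S.Aᵀ * S.P * S.B * S.K := by
    conv_lhs => rw [hDARE]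
    rw [K, Matrix.mul_assoc _ _ (S.Bᵀ * S.P * S.A)]
  -- The Lyapunov form of the Riccati equation: the normal equation `hK` for the gain cancels the
  -- terms quadratic in K.
  have hmat : (S.A - S.B * S.K)ᵀ * S.P * (S.A - S.B * S.K) + (S.Q + S.Kᵀ * S.R * S.K) = S.P := by
    have h1 : S.Kᵀ * ((S.R + S.Bᵀ * S.P * S.B) * S.K) = S.Kᵀ * (S.Bᵀ * S.P * S.A) := by rw [hK]
    conv_rhs => rw [hD]
    simp only [Matrix.transpose_sub, Matrix.transpose_mul, Matrix.sub_mul, Matrix.mul_sub,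
      Matrix.add_mul, Matrix.mul_add, Matrix.mul_assoc] at h1 ⊢
    rw [← h1]
    abel
  have hgen : ∀ {n k : ℕ} (M : Matrix (Fin n) (Fin n) ℝ) (T : Matrix (Fin n) (Fin k) ℝ)
      (y : Fin k → ℝ), wsq M (T *ᵥ y) = y ⬝ᵥ ((Tᵀ * M * T) *ᵥ y) := by
    intro n k M T y
    rw [wsq, ← Matrix.mulVec_mulVec, ← Matrix.mulVec_mulVec, Matrix.dotProduct_mulVec y,
      Matrix.vecMul_transpose]
  have h1 : S.A *ᵥ x + S.B *ᵥ (-(S.K *ᵥ x)) = (S.A - S.B * S.K) *ᵥ x := by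
    rw [Matrix.sub_mulVec, Matrix.mulVec_neg, Matrix.mulVec_mulVec, sub_eq_add_neg]
  rw [(isNonnegQuadratic_wsq hR.posSemidef).map_neg, h1, hgen, hgen, wsq, wsq,
    ← dotProduct_add, ← dotProduct_add, ← Matrix.add_mulVec, ← Matrix.add_mulVec, hmat]

/-- The LQR loop is exponentially stable. -/
lemma exists_Acl_pow_le (hQ : S.Q.PosSemidef) (hdet : IsDetectable S.A S.Q) (hR : S.R.PosDef)
    (hP : S.P.PosSemidef) (hDARE : S.SolvesDARE) :
    ∃ C ρ : ℝ, 0 < C ∧ 0 ≤ ρ ∧ ρ < 1 ∧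
      ∀ (j : ℕ) (x : Fin nx → ℝ), ‖(S.Acl ^ j) *ᵥ x‖ ^ 2 ≤ C * ρ ^ j * ‖x‖ ^ 2 := by
  obtain ⟨a, C, γ, hC, hγ0, hγ1, -, hge, hle, hsto⟩ := exists_storage_norm S.B hQ hdet hR
  obtain ⟨c, hc, hcP⟩ := (isNonnegQuadratic_wsq hP).exists_le
  have ha0 : ∀ x, 0 ≤ a x := fun x => (norm_nonneg x).trans (hge x)
  have hcP' : ∀ x, wsq S.P x ≤ c * a x ^ 2 := fun x => (hcP x).trans (by gcongr; exact hge x)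
  -- The decrease of C times the P-term pays for the stage cost in the storage inequality, leaving
  -- −(1 − γ) a²; κ turns this into a fraction of W.
  set W : (Fin nx → ℝ) → ℝ := fun x => C * wsq S.P x + a x ^ 2 with hW
  have h1γ : 0 < 1 - γ := by linarith
  set κ := (1 - γ) / (C * c + 1) with hκ
  have hκ0 : 0 < κ := by positivity
  have hκ1 : κ ≤ 1 := by
    rw [hκ, div_le_one (by positivity)]
    nlinarith
  have hstep : ∀ x, W (S.Acl *ᵥ x) ≤ (1 - κ) * W x := by
    intro x
    have h1 : S.Acl *ᵥ x = S.A *ᵥ x + S.B *ᵥ (-(S.K *ᵥ x)) := by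
      rw [Acl, Matrix.sub_mulVec, Matrix.mulVec_neg, Matrix.mulVec_mulVec, sub_eq_add_neg]
    have h2 := wsq_lqr hR hP hDARE x
    have h3 := hsto x (-(S.K *ᵥ x))
    rw [← h1] at h2 h3
    have h4 : κ * W x ≤ (1 - γ) * a x ^ 2 := by
      rw [hκ, div_mul_eq_mul_div, div_le_iff₀ (by positivity)]
      have := hcP' x
      calc (1 - γ) * W x ≤ (1 - γ) * (C * (c * a x ^ 2) + a x ^ 2) := by
            simp only [hW]
            gcongr
        _ = _ := by ring
    simp only [hW] at h4 ⊢
    nlinarith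
  have hpow : ∀ j x, W ((S.Acl ^ j) *ᵥ x) ≤ (1 - κ) ^ j * W x := by
    intro j
    induction j with
    | zero => simp
    | succ j ih =>
      intro x
      rw [pow_succ', ← Matrix.mulVec_mulVec, pow_succ', mul_assoc]
      exact (hstep _).trans (mul_le_mul_of_nonneg_left (ih x) (by linarith))
  refine ⟨C * c + C ^ 2, 1 - κ, by positivity, by linarith, by linarith, fun j x => ?_⟩
  calc ‖(S.Acl ^ j) *ᵥ x‖ ^ 2 ≤ a ((S.Acl ^ j) *ᵥ x) ^ 2 := by gcongr; exact hge _
    _ ≤ W ((S.Acl ^ j) *ᵥ x) := by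
      have := mul_nonneg hC.le ((isNonnegQuadratic_wsq hP).nonneg ((S.Acl ^ j) *ᵥ x))
      simp only [hW]
      linarith
    _ ≤ (1 - κ) ^ j * W x := hpow j x
    _ ≤ (1 - κ) ^ j * (C * (c * ‖x‖ ^ 2) + (C * ‖x‖) ^ 2) := by
      have h0 : 0 ≤ 1 - κ := by linarith
      have h1 : a x ^ 2 ≤ (C * ‖x‖) ^ 2 := by
        gcongr
        · exact ha0 x
        · exact hle x
      have h2 := hcP x
      simp only [hW]
      gcongr
    _ = _ := by ring

end Setup

/-! ### Equilibria and the terminal set -/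

namespace Setup

variable {nx nu ny nz m : ℕ} {S : Setup nx nu ny nz m}

lemma xbar_equilibrium (hG : S.IsEquilibriumBasis) (v : Fin nz → ℝ) :
    S.A *ᵥ S.xbar v + S.B *ᵥ S.ubar v = S.xbar v := by
  have hZG : S.Z * S.G = 0 := by
    ext i j
    have hj : (fun i => S.G i j) ∈ LinearMap.ker S.Z.mulVecLin := by
      rw [← hG.2]
      exact Submodule.subset_span ⟨j, rfl⟩
    exact congrFun (LinearMap.mem_ker.1 hj) i
  have h : (S.A - 1) * S.Gx + S.B * S.Gu = 0 := by
    have := congrArg Matrix.toRows₁ hZG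
    rw [Z, Matrix.fromRows_mul, Matrix.toRows₁_fromRows, G, Matrix.fromCols_mul_fromRows,
      Matrix.fromCols_mul_fromRows, Matrix.zero_mul, add_zero] at this
    exact this
  have h2 := congrArg (fun M => M *ᵥ v) h
  simp only [Matrix.add_mulVec, ← Matrix.mulVec_mulVec, Matrix.sub_mulVec, Matrix.one_mulVec,
    Matrix.zero_mulVec] at h2
  rw [xbar, ubar, ← sub_eq_zero, ← h2]
  abel

lemma lqrState_eq (hG : S.IsEquilibriumBasis) (x : Fin nx → ℝ) (v : Fin nz → ℝ) (j : ℕ) :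
    S.lqrState x v j = S.xbar v + (S.Acl ^ j) *ᵥ (x - S.xbar v) := by
  induction j with
  | zero => simp [lqrState]
  | succ j ih =>
    have h := xbar_equilibrium hG v
    rw [lqrState, lqrInput, ih, add_sub_cancel_left, pow_succ', ← Matrix.mulVec_mulVec]
    generalize S.Acl ^ j *ᵥ (x - S.xbar v) = e
    rw [Acl, Matrix.mulVec_add, Matrix.mulVec_sub, Matrix.sub_mulVec, Matrix.mulVec_mulVec]
    conv_rhs => rw [← h]
    abel

lemma steady_output_eq (v : Fin nz → ℝ) :
    S.C *ᵥ S.xbar v + S.D *ᵥ S.ubar v = (S.C * S.Gx + S.D * S.Gu) *ᵥ v := by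
  rw [xbar, ubar, Matrix.mulVec_mulVec, Matrix.mulVec_mulVec, Matrix.add_mulVec]

lemma lqr_output_eq (hG : S.IsEquilibriumBasis) (x : Fin nx → ℝ) (v : Fin nz → ℝ) (j : ℕ) :
    S.C *ᵥ S.lqrState x v j + S.D *ᵥ S.lqrInput v (S.lqrState x v j)
      = (S.C - S.D * S.K) *ᵥ ((S.Acl ^ j) *ᵥ (x - S.xbar v))
        + (S.C * S.Gx + S.D * S.Gu) *ᵥ v := by
  rw [lqrInput, lqrState_eq hG, add_sub_cancel_left, ← steady_output_eq]
  generalize S.Acl ^ j *ᵥ (x - S.xbar v) = e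
  rw [Matrix.mulVec_add, Matrix.mulVec_sub, Matrix.sub_mulVec, Matrix.mulVec_mulVec]
  abel

lemma mem_terminalSet_iff (hG : S.IsEquilibriumBasis) {x : Fin nx → ℝ} {v : Fin nz → ℝ} :
    (x, v) ∈ S.terminalSet ↔ v ∈ S.admissibleRefs ∧
      ∀ j : ℕ, (S.C - S.D * S.K) *ᵥ ((S.Acl ^ j) *ᵥ (x - S.xbar v))
        + (S.C * S.Gx + S.D * S.Gu) *ᵥ v ∈ S.constraintSet := by
  simp only [terminalSet, Set.mem_ofPred_eq, lqr_output_eq hG, steady_output_eq, admissibleRefs]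

lemma isPolyhedron_constraintSet : IsPolyhedron S.constraintSet := by
  refine ⟨Fin m, inferInstance, fun i =>
    LinearMap.toContinuousLinearMap ((LinearMap.proj i).comp S.Y.mulVecLin), S.h, ?_⟩
  ext y
  simp [constraintSet, Pi.le_def]

lemma isPolyhedron_admissibleRefs (hε : S.ε ∈ Set.Ioo (0 : ℝ) 1) :
    IsPolyhedron S.admissibleRefs := by
  have h1 : (0 : ℝ) < 1 - S.ε := by linarith [hε.2]
  have := (isPolyhedron_constraintSet (S := S)).preimage (LinearMap.toContinuousLinearMap
    ((1 - S.ε)⁻¹ • (S.C * S.Gx + S.D * S.Gu).mulVecLin))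
  convert this using 1
  ext v
  simp only [admissibleRefs, Set.mem_ofPred_eq, Set.mem_smul_set_iff_inv_smul_mem₀ h1.ne',
    Set.mem_preimage]
  rfl

lemma zero_mem_admissibleRefs (hYzero : (0 : Fin ny → ℝ) ∈ interior S.constraintSet) :
    0 ∈ S.admissibleRefs := by
  simp only [admissibleRefs, Set.mem_ofPred_eq, Matrix.mulVec_zero]
  exact ⟨0, interior_subset hYzero, by simp⟩

/-- Outputs close to an admissible steady-state output satisfy the constraints. -/
lemma exists_margin (hε : S.ε ∈ Set.Ioo (0 : ℝ) 1)
    (hYzero : (0 : Fin ny → ℝ) ∈ interior S.constraintSet) :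
    ∃ δ, 0 < δ ∧ ∀ v ∈ S.admissibleRefs, ∀ y : Fin ny → ℝ, ‖y‖ ≤ δ →
      y + (S.C * S.Gx + S.D * S.Gu) *ᵥ v ∈ S.constraintSet := by
  obtain ⟨δ, hδ, hball⟩ := Metric.mem_nhds_iff.1 (mem_interior_iff_mem_nhds.1 hYzero)
  have hε0 := hε.1
  -- The output is the convex combination ε (ε⁻¹ y) + (1 − ε) w, with ε⁻¹ y in the ball around 0 and
  -- w in the constraint set.
  refine ⟨S.ε * (δ / 2), by positivity, ?_⟩
  rintro v ⟨w, hw, hwv⟩ y hy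
  have hmem : S.ε⁻¹ • y ∈ S.constraintSet := by
    apply hball
    rw [mem_ball_zero_iff, norm_smul, norm_inv, Real.norm_of_nonneg hε0.le,
      inv_mul_lt_iff₀ hε0]
    nlinarith
  have h := (isPolyhedron_constraintSet (S := S)).convex hmem hw hε0.le
    (show 0 ≤ 1 - S.ε by linarith [hε.2]) (by ring)
  rw [smul_inv_smul₀ hε0.ne'] at h
  rw [← hwv]
  exact h

lemma steady_output_mem (hε : S.ε ∈ Set.Ioo (0 : ℝ) 1)
    (hYzero : (0 : Fin ny → ℝ) ∈ interior S.constraintSet) {v : Fin nz → ℝ}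
    (hv : v ∈ S.admissibleRefs) :
    (S.C * S.Gx + S.D * S.Gu) *ᵥ v ∈ S.constraintSet := by
  obtain ⟨δ, hδ, h⟩ := exists_margin hε hYzero
  simpa using h v hv 0 (by simpa using hδ.le)

/-- The observability map truncated at a horizon beyond which its kernel does not shrink. -/
lemma exists_stable_kernel {n k : ℕ} (H : Matrix (Fin k) (Fin n) ℝ)
    (M : Matrix (Fin n) (Fin n) ℝ) :
    ∃ J : ℕ, ∀ x : Fin n → ℝ, (∀ j < J, H *ᵥ ((M ^ j) *ᵥ x) = 0) →
      ∀ j, H *ᵥ ((M ^ j) *ᵥ x) = 0 := by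
  -- The decreasing chain of truncated unobservable subspaces, which stabilizes by the Artinian
  -- property.
  let f : ℕ →o (Submodule ℝ (Fin n → ℝ))ᵒᵈ :=
    ⟨fun J => OrderDual.toDual (⨅ j : Fin J, LinearMap.ker (H * M ^ (j : ℕ)).mulVecLin),
      fun a b hab => OrderDual.toDual_le_toDual.2 (le_iInf fun j =>
        iInf_le (fun j : Fin b => LinearMap.ker (H * M ^ (j : ℕ)).mulVecLin)
          ⟨j, j.2.trans_le hab⟩)⟩
  obtain ⟨J, hJ⟩ := IsArtinian.monotone_stabilizes f
  have hmem : ∀ J x, x ∈ (OrderDual.ofDual (f J) : Submodule ℝ (Fin n → ℝ)) ↔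
      ∀ j < J, H *ᵥ ((M ^ j) *ᵥ x) = 0 := by
    intro J x
    change x ∈ ⨅ j : Fin J, LinearMap.ker (H * M ^ (j : ℕ)).mulVecLin ↔ _
    simp [Submodule.mem_iInf, Fin.forall_iff]
  refine ⟨J, fun x hx j => ?_⟩
  have h1 := (hmem J x).2 hx
  rw [hJ (J + j + 1) (by omega), hmem] at h1
  exact h1 j (by omega)

/-- Bounded observations over a long enough window force all later observations to be small. -/
lemma exists_observation_bound {n k : ℕ} (H : Matrix (Fin k) (Fin n) ℝ)
    (M : Matrix (Fin n) (Fin n) ℝ) {C ρ : ℝ} (hC : 0 < C) (hρ : 0 ≤ ρ) (hρ1 : ρ < 1)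
    (hM : ∀ (j : ℕ) (x : Fin n → ℝ), ‖(M ^ j) *ᵥ x‖ ^ 2 ≤ C * ρ ^ j * ‖x‖ ^ 2)
    {b δ : ℝ} (hδ : 0 < δ) :
    ∃ J : ℕ, ∀ x : Fin n → ℝ, (∀ j < J, ‖H *ᵥ ((M ^ j) *ᵥ x)‖ ≤ b) →
      ∀ j ≥ J, ‖H *ᵥ ((M ^ j) *ᵥ x)‖ ≤ δ := by
  obtain ⟨J₀, hJ₀⟩ := exists_stable_kernel H M
  obtain ⟨c, hc, hH⟩ := exists_norm_mulVec_le H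
  set O : (Fin n → ℝ) →ₗ[ℝ] (Fin J₀ → Fin k → ℝ) :=
    LinearMap.pi fun j => (H * M ^ (j : ℕ)).mulVecLin with hO
  have hOapp : ∀ x (j : Fin J₀), O x j = H *ᵥ ((M ^ (j : ℕ)) *ᵥ x) := by
    intro x j
    simp [hO]
  -- The pair need not be observable, so bounded observations do not bound x. Replacing x by s (O x)
  -- changes it by an unobservable vector only and gives a bounded state, to which the decay
  -- applies.
  obtain ⟨s, hs⟩ := O.rangeRestrict.exists_rightInverse_of_surjective O.range_rangeRestrict
  set s' := LinearMap.toContinuousLinearMap s with hs'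
  set b' := max b 0 with hb'
  have hb0 : 0 ≤ b' := le_max_right _ _
  have hlim : Filter.Tendsto (fun j : ℕ => c ^ 2 * (C * ρ ^ j * (‖s'‖ * b') ^ 2)) Filter.atTop
      (nhds (c ^ 2 * (C * 0 * (‖s'‖ * b') ^ 2))) :=
    (((tendsto_pow_atTop_nhds_zero_of_lt_one hρ hρ1).const_mul C).mul_const _).const_mul _
  simp only [mul_zero, zero_mul] at hlim
  obtain ⟨J₁, hJ₁⟩ := Filter.eventually_atTop.1
    (hlim.eventually_lt_const (show (0 : ℝ) < δ ^ 2 by positivity))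
  refine ⟨max J₀ J₁, fun x hx j hj => ?_⟩
  set y := O.rangeRestrict x with hy
  have hyn : ‖y‖ ≤ b' := by
    change ‖O x‖ ≤ b'
    rw [pi_norm_le_iff_of_nonneg hb0]
    intro i
    rw [hOapp]
    exact (hx i (lt_of_lt_of_le i.2 (le_max_left _ _))).trans (le_max_left _ _)
  have hOs : O (s y) = O x := by
    have := LinearMap.congr_fun hs y
    exact congrArg Subtype.val this
  have hker : H *ᵥ ((M ^ j) *ᵥ (x - s y)) = 0 := by
    refine hJ₀ _ (fun i hi => ?_) j
    have : O (x - s y) ⟨i, hi⟩ = 0 := by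
      rw [map_sub, hOs, sub_self]
      rfl
    rwa [hOapp] at this
  have heq : H *ᵥ ((M ^ j) *ᵥ x) = H *ᵥ ((M ^ j) *ᵥ (s y)) := by
    rwa [Matrix.mulVec_sub, Matrix.mulVec_sub, sub_eq_zero] at hker
  have hsy : ‖s y‖ ≤ ‖s'‖ * b' := (s'.le_opNorm y).trans (by gcongr)
  rw [heq, ← sq_le_sq₀ (norm_nonneg _) hδ.le]
  calc ‖H *ᵥ ((M ^ j) *ᵥ (s y))‖ ^ 2 ≤ (c * ‖(M ^ j) *ᵥ (s y)‖) ^ 2 := by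
        gcongr
        exact hH _
    _ = c ^ 2 * ‖(M ^ j) *ᵥ (s y)‖ ^ 2 := by ring
    _ ≤ c ^ 2 * (C * ρ ^ j * ‖s y‖ ^ 2) := by
      gcongr
      exact hM j _
    _ ≤ c ^ 2 * (C * ρ ^ j * (‖s'‖ * b') ^ 2) := by gcongr
    _ ≤ δ ^ 2 := (hJ₁ j ((le_max_right _ _).trans hj)).le

/-- The terminal set is a polyhedron, because finitely many of its constraints imply the others. -/
lemma isPolyhedron_terminalSet (hG : S.IsEquilibriumBasis) (hε : S.ε ∈ Set.Ioo (0 : ℝ) 1)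
    (hYcompact : IsCompact S.constraintSet)
    (hYzero : (0 : Fin ny → ℝ) ∈ interior S.constraintSet)
    (hQ : S.Q.PosSemidef) (hdet : IsDetectable S.A S.Q) (hR : S.R.PosDef)
    (hP : S.P.PosSemidef) (hDARE : S.SolvesDARE) : IsPolyhedron S.terminalSet := by
  obtain ⟨C, ρ, hC, hρ, hρ1, hpow⟩ := exists_Acl_pow_le hQ hdet hR hP hDARE
  obtain ⟨δ, hδ, hmargin⟩ := exists_margin hε hYzero
  obtain ⟨b, hb⟩ := isBounded_iff_forall_norm_le.1 hYcompact.isBounded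
  -- The transient output is a difference of two points of the compact constraint set, hence the
  -- bound 2 b.
  obtain ⟨J, hJ⟩ := exists_observation_bound (S.C - S.D * S.K) S.Acl hC hρ hρ1 hpow
    (b := 2 * b) hδ
  set out : ℕ → (Fin nx → ℝ) × (Fin nz → ℝ) →ₗ[ℝ] (Fin ny → ℝ) := fun j =>
    ((S.C - S.D * S.K) * S.Acl ^ j).mulVecLin ∘ₗ
      (LinearMap.fst ℝ _ _ - S.Gx.mulVecLin ∘ₗ LinearMap.snd ℝ _ _)
    + (S.C * S.Gx + S.D * S.Gu).mulVecLin ∘ₗ LinearMap.snd ℝ _ _ with hout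
  have houtapp : ∀ j x v, out j (x, v) = (S.C - S.D * S.K) *ᵥ ((S.Acl ^ j) *ᵥ (x - S.xbar v))
        + (S.C * S.Gx + S.D * S.Gu) *ᵥ v := by
    intro j x v
    simp only [hout, LinearMap.add_apply, LinearMap.comp_apply, LinearMap.sub_apply,
      Matrix.mulVecLin_apply, LinearMap.fst_apply, LinearMap.snd_apply, Matrix.mulVec_mulVec, xbar]
  have h1 := ((isPolyhedron_admissibleRefs hε).preimage
    (ContinuousLinearMap.snd ℝ (Fin nx → ℝ) (Fin nz → ℝ))).inter
    (IsPolyhedron.iInter fun j : Fin J => (isPolyhedron_constraintSet (S := S)).preimage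
      (LinearMap.toContinuousLinearMap (out j)))
  convert h1 using 1
  ext ⟨x, v⟩
  simp only [mem_terminalSet_iff hG, Set.mem_inter_iff, Set.mem_preimage, Set.mem_iInter,
    LinearMap.coe_toContinuousLinearMap', houtapp, ContinuousLinearMap.coe_snd']
  refine and_congr_right fun hv => ⟨fun h j => h j, fun h j => ?_⟩
  rcases lt_or_ge j J with hj | hj
  · exact h ⟨j, hj⟩
  · refine hmargin v hv _ (hJ _ (fun i hi => ?_) j hj)
    have h2 := hb _ (h ⟨i, hi⟩)
    have h3 := hb _ (steady_output_mem hε hYzero hv)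
    have h4 := norm_sub_le ((S.C - S.D * S.K) *ᵥ ((S.Acl ^ i) *ᵥ (x - S.xbar v))
        + (S.C * S.Gx + S.D * S.Gu) *ᵥ v) ((S.C * S.Gx + S.D * S.Gu) *ᵥ v)
    rw [add_sub_cancel_right] at h4
    linarith

/-- States close to an admissible equilibrium lie in the terminal set. -/
lemma exists_terminal_radius (hG : S.IsEquilibriumBasis) (hε : S.ε ∈ Set.Ioo (0 : ℝ) 1)
    (hYzero : (0 : Fin ny → ℝ) ∈ interior S.constraintSet)
    (hQ : S.Q.PosSemidef) (hdet : IsDetectable S.A S.Q) (hR : S.R.PosDef)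
    (hP : S.P.PosSemidef) (hDARE : S.SolvesDARE) :
    ∃ r, 0 < r ∧ ∀ v ∈ S.admissibleRefs, ∀ x, ‖x - S.xbar v‖ ≤ r → (x, v) ∈ S.terminalSet := by
  obtain ⟨C, ρ, hC, hρ, hρ1, hpow⟩ := exists_Acl_pow_le hQ hdet hR hP hDARE
  obtain ⟨δ, hδ, hmargin⟩ := exists_margin hε hYzero
  obtain ⟨c, hc, hH⟩ := exists_norm_mulVec_le (S.C - S.D * S.K)
  have hsq : 0 < Real.sqrt C := Real.sqrt_pos.2 hC
  refine ⟨δ / (c * Real.sqrt C), by positivity, fun v hv x hx => ?_⟩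
  rw [mem_terminalSet_iff hG]
  refine ⟨hv, fun j => hmargin v hv _ ?_⟩
  have h1 : ‖(S.Acl ^ j) *ᵥ (x - S.xbar v)‖ ≤ Real.sqrt C * ‖x - S.xbar v‖ := by
    rw [← sq_le_sq₀ (norm_nonneg _) (by positivity), mul_pow, Real.sq_sqrt hC.le]
    refine (hpow j _).trans ?_
    have : ρ ^ j ≤ 1 := pow_le_one₀ hρ hρ1.le
    have h0 : C * ρ ^ j ≤ C := by nlinarith
    gcongr
  calc _ ≤ c * ‖(S.Acl ^ j) *ᵥ (x - S.xbar v)‖ := hH _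
    _ ≤ c * (Real.sqrt C * (δ / (c * Real.sqrt C))) := by
      gcongr
      exact h1.trans (by gcongr)
    _ = δ := by field_simp

/-! ### The optimal control problem as a parametric quadratic program -/

section OptimalControl

variable {N : ℕ}

lemma predState_zero (x : Fin nx → ℝ) (μ : Fin N → Fin nu → ℝ) : S.predState x μ 0 = x := rfl

lemma predState_succ (x : Fin nx → ℝ) (μ : Fin N → Fin nu → ℝ) (i : Fin N) :
    S.predState x μ i.succ = S.A *ᵥ S.predState x μ i.castSucc + S.B *ᵥ μ i :=
  Fin.induction_succ ..

lemma exists_predState_linear (i : Fin (N + 1)) :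
    ∃ l : ((Fin nx → ℝ) × (Fin nz → ℝ)) × (Fin N → Fin nu → ℝ) →ₗ[ℝ] (Fin nx → ℝ),
      ∀ p, l p = S.predState p.1.1 p.2 i := by
  induction i using Fin.induction with
  | zero => exact ⟨LinearMap.fst ℝ _ _ ∘ₗ LinearMap.fst ℝ _ _, fun p => rfl⟩
  | succ i ih =>
    obtain ⟨l, hl⟩ := ih
    refine ⟨S.A.mulVecLin ∘ₗ l + S.B.mulVecLin ∘ₗ LinearMap.proj i ∘ₗ LinearMap.snd ℝ _ _,
      fun p => ?_⟩
    simp [predState_succ, hl]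

variable (S N) in
/-- The graph of the feasible set of the optimal control problem. -/
def ocpGraph : Set (((Fin nx → ℝ) × (Fin nz → ℝ)) × (Fin N → Fin nu → ℝ)) :=
  {p | p.2 ∈ S.ocpFeasible N p.1.1 p.1.2}

lemma fst_image_ocpGraph : Prod.fst '' S.ocpGraph N = S.Gam N := by
  ext p
  constructor
  · rintro ⟨⟨p, μ⟩, h, rfl⟩
    exact ⟨μ, h⟩
  · rintro ⟨μ, h⟩
    exact ⟨(p, μ), h, rfl⟩

lemma isPolyhedron_ocpGraph (hT : IsPolyhedron S.terminalSet) : IsPolyhedron (S.ocpGraph N) := by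
  choose l hl using fun i : Fin (N + 1) => exists_predState_linear (S := S) i
  let out : Fin N → ((Fin nx → ℝ) × (Fin nz → ℝ)) × (Fin N → Fin nu → ℝ) →ₗ[ℝ] (Fin ny → ℝ) :=
    fun i => S.C.mulVecLin ∘ₗ l i.castSucc
      + S.D.mulVecLin ∘ₗ LinearMap.proj i ∘ₗ LinearMap.snd ℝ _ _
  let fin : ((Fin nx → ℝ) × (Fin nz → ℝ)) × (Fin N → Fin nu → ℝ) →ₗ[ℝ]
      (Fin nx → ℝ) × (Fin nz → ℝ) :=
    (l (Fin.last N)).prod (LinearMap.snd ℝ _ _ ∘ₗ LinearMap.fst ℝ _ _)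
  have h1 := (IsPolyhedron.iInter fun i : Fin N => (isPolyhedron_constraintSet (S := S)).preimage
    (LinearMap.toContinuousLinearMap (out i))).inter
    (hT.preimage (LinearMap.toContinuousLinearMap fin))
  convert h1 using 1
  ext p
  simp only [ocpGraph, ocpFeasible, Set.mem_ofPred_eq, Set.mem_inter_iff, Set.mem_iInter,
    Set.mem_preimage, LinearMap.coe_toContinuousLinearMap', out, fin, LinearMap.add_apply,
    LinearMap.comp_apply, Matrix.mulVecLin_apply, LinearMap.prod_apply, Function.prod, hl,
    LinearMap.proj_apply, LinearMap.fst_apply, LinearMap.snd_apply]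

/-- Joint in state, reference and inputs, so that a change of parameters is just a displacement in
the argument of one form. -/
lemma isNonnegQuadratic_ocpCost (hQ : S.Q.PosSemidef) (hR : S.R.PosDef) (hP : S.P.PosSemidef) :
    IsNonnegQuadratic (fun p : ((Fin nx → ℝ) × (Fin nz → ℝ)) × (Fin N → Fin nu → ℝ) =>
      S.ocpCost p.1.1 p.1.2 p.2) := by
  choose l hl using fun i : Fin (N + 1) => exists_predState_linear (S := S) i
  set vl : ((Fin nx → ℝ) × (Fin nz → ℝ)) × (Fin N → Fin nu → ℝ) →ₗ[ℝ] (Fin nz → ℝ) :=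
    LinearMap.snd ℝ _ _ ∘ₗ LinearMap.fst ℝ _ _ with hvl
  have h1 := ((isNonnegQuadratic_wsq hP).comp (l (Fin.last N) - S.Gx.mulVecLin ∘ₗ vl)).add
    (IsNonnegQuadratic.sum fun i : Fin N =>
      ((isNonnegQuadratic_wsq hQ).comp (l i.castSucc - S.Gx.mulVecLin ∘ₗ vl)).add
      ((isNonnegQuadratic_wsq hR.posSemidef).comp
        (LinearMap.proj i ∘ₗ LinearMap.snd ℝ _ _ - S.Gu.mulVecLin ∘ₗ vl)))
  convert h1 using 2 with p
  simp [ocpCost, hl, hvl, xbar, ubar]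

lemma ocpCost_pos_of_ne_zero (hQ : S.Q.PosSemidef) (hR : S.R.PosDef) (hP : S.P.PosSemidef)
    {μ : Fin N → Fin nu → ℝ} (hμ : μ ≠ 0) : 0 < S.ocpCost 0 0 μ := by
  obtain ⟨i, hi⟩ := Function.ne_iff.1 hμ
  refine add_pos_of_nonneg_of_pos ((isNonnegQuadratic_wsq hP).nonneg _) ?_
  refine Finset.sum_pos' (fun i _ => add_nonneg ((isNonnegQuadratic_wsq hQ).nonneg _)
    ((isNonnegQuadratic_wsq hR.posSemidef).nonneg _)) ⟨i, Finset.mem_univ i, ?_⟩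
  refine add_pos_of_nonneg_of_pos ((isNonnegQuadratic_wsq hQ).nonneg _) (wsq_pos hR ?_)
  simpa [ubar] using hi

/-- The optimal control problem has a unique solution wherever it is feasible. -/
lemma existsUnique_ocp (hQ : S.Q.PosSemidef) (hR : S.R.PosDef) (hP : S.P.PosSemidef)
    (hT : IsPolyhedron S.terminalSet) {x : Fin nx → ℝ} {v : Fin nz → ℝ}
    (h : (x, v) ∈ S.Gam N) :
    ∃! μ, IsMinimizer (S.ocpCost x v) (S.ocpFeasible N x v) μ := by
  have hgraph := isPolyhedron_ocpGraph (N := N) hT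
  have hcont : Continuous fun μ : Fin N → Fin nu → ℝ => ((x, v), μ) := by fun_prop
  have heq : S.ocpFeasible N x v = (fun μ => ((x, v), μ)) ⁻¹' S.ocpGraph N := rfl
  have hclosed : IsClosed (S.ocpFeasible N x v) := hgraph.isClosed.preimage hcont
  have hconv : Convex ℝ (S.ocpFeasible N x v) := by
    intro μ hμ μ' hμ' a b ha hb hab
    have := hgraph.convex (x := ((x, v), μ)) (y := ((x, v), μ')) hμ hμ' ha hb hab
    simp only [Prod.smul_mk, Prod.mk_add_mk, ← add_smul, hab, one_smul] at this
    exact this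
  have := (isNonnegQuadratic_ocpCost hQ hR hP).existsUnique_minimizer
    (LinearMap.inr ℝ ((Fin nx → ℝ) × (Fin nz → ℝ)) (Fin N → Fin nu → ℝ))
    (fun μ hμ => ocpCost_pos_of_ne_zero hQ hR hP hμ) ((x, v), 0) hconv hclosed h
  simpa using this

lemma lqrState_add (x : Fin nx → ℝ) (v : Fin nz → ℝ) (i j : ℕ) :
    S.lqrState (S.lqrState x v i) v j = S.lqrState x v (i + j) := by
  induction j with
  | zero => rfl
  | succ j ih => rw [← add_assoc, lqrState, ih, lqrState]

lemma predState_lqr (x : Fin nx → ℝ) (v : Fin nz → ℝ) (i : Fin (N + 1)) :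
    S.predState x (fun i : Fin N => S.lqrInput v (S.lqrState x v i)) i = S.lqrState x v i := by
  induction i using Fin.induction with
  | zero => rfl
  | succ i ih => rw [predState_succ, ih]; rfl

/-- On the terminal set the LQR input sequence is feasible. -/
lemma lqr_mem_ocpFeasible {x : Fin nx → ℝ} {v : Fin nz → ℝ} (h : (x, v) ∈ S.terminalSet) :
    (fun i : Fin N => S.lqrInput v (S.lqrState x v i)) ∈ S.ocpFeasible N x v := by
  refine ⟨fun i => ?_, ?_⟩
  · rw [predState_lqr]
    exact h.2 i
  · rw [predState_lqr]
    refine ⟨h.1, fun j => ?_⟩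
    rw [lqrState_add]
    exact h.2 _

lemma terminalSet_subset_Gam : S.terminalSet ⊆ S.Gam N :=
  fun _ h => ⟨_, lqr_mem_ocpFeasible h⟩

lemma ocpCost_lqr_xbar (hG : S.IsEquilibriumBasis) (v : Fin nz → ℝ) :
    S.ocpCost (S.xbar v) v
      (fun i : Fin N => S.lqrInput v (S.lqrState (S.xbar v) v i)) = 0 := by
  have h : ∀ j, S.lqrState (S.xbar v) v j = S.xbar v := by
    intro j
    simp [lqrState_eq hG]
  have h2 : ∀ j, S.lqrInput v (S.lqrState (S.xbar v) v j) = S.ubar v := by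
    intro j
    simp [h, lqrInput]
  simp only [ocpCost, predState_lqr]
  simp only [h2]
  simp only [h, sub_self, wsq, zero_dotProduct, add_zero, Finset.sum_const_zero]

end OptimalControl

end Setup

namespace Setup

variable {nx nu ny nz m : ℕ} {S : Setup nx nu ny nz m}

/-! ### Shifted input sequences and recursive feasibility -/

section Shift

variable {n : ℕ}

lemma predState_tail (x : Fin nx → ℝ) (μ : Fin (n + 1) → Fin nu → ℝ) (i : Fin (n + 1)) :
    S.predState x μ i.succ = S.predState (S.A *ᵥ x + S.B *ᵥ μ 0) (Fin.tail μ) i := by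
  induction i using Fin.induction with
  | zero => rfl
  | succ i ih =>
    rw [predState_succ, predState_succ, ← Fin.succ_castSucc, ih]
    rfl

lemma predState_snoc (x : Fin nx → ℝ) (μ : Fin n → Fin nu → ℝ) (u : Fin nu → ℝ)
    (i : Fin (n + 1)) :
    S.predState x (Fin.snoc μ u : Fin (n + 1) → Fin nu → ℝ) i.castSucc = S.predState x μ i := by
  induction i using Fin.induction with
  | zero => rfl
  | succ i ih =>
    rw [← Fin.succ_castSucc, predState_succ, predState_succ, ih, Fin.snoc_castSucc]

variable (S) in
/-- The input sequence shifted by one step and extended by the LQR law. -/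
def shift (x : Fin nx → ℝ) (v : Fin nz → ℝ) (μ : Fin (n + 1) → Fin nu → ℝ) :
    Fin (n + 1) → Fin nu → ℝ :=
  Fin.snoc (Fin.tail μ) (S.lqrInput v (S.predState x μ (Fin.last (n + 1))))

lemma predState_shift_castSucc (x : Fin nx → ℝ) (v : Fin nz → ℝ)
    (μ : Fin (n + 1) → Fin nu → ℝ) (i : Fin (n + 1)) :
    S.predState (S.A *ᵥ x + S.B *ᵥ μ 0) (S.shift x v μ) i.castSucc = S.predState x μ i.succ := by
  rw [shift, predState_snoc, predState_tail]

lemma predState_shift_last (x : Fin nx → ℝ) (v : Fin nz → ℝ) (μ : Fin (n + 1) → Fin nu → ℝ) :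
    S.predState (S.A *ᵥ x + S.B *ᵥ μ 0) (S.shift x v μ) (Fin.last (n + 1))
      = S.lqrState (S.predState x μ (Fin.last (n + 1))) v 1 := by
  rw [← Fin.succ_last, predState_succ, predState_shift_castSucc, shift, Fin.snoc_last,
    Fin.succ_last]
  rfl

lemma shift_mem_ocpFeasible {x : Fin nx → ℝ} {v : Fin nz → ℝ} {μ : Fin (n + 1) → Fin nu → ℝ}
    (h : μ ∈ S.ocpFeasible (n + 1) x v) :
    S.shift x v μ ∈ S.ocpFeasible (n + 1) (S.A *ᵥ x + S.B *ᵥ μ 0) v := by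
  refine ⟨fun i => ?_, ?_⟩
  · rw [predState_shift_castSucc]
    refine Fin.lastCases ?_ (fun i => ?_) i
    -- The appended stage is the old terminal state under the LQR law: the j = 0 condition of the
    -- terminal set.
    · rw [shift, Fin.snoc_last, Fin.succ_last]
      exact h.2.2 0
    · rw [shift, Fin.snoc_castSucc, Fin.succ_castSucc]
      exact h.1 i.succ
  · rw [predState_shift_last]
    refine ⟨h.2.1, fun j => ?_⟩
    rw [lqrState_add]
    exact h.2.2 _

/-- By the Riccati equation the appended stage cost and the new terminal cost add up exactly to the
old terminal cost, so only the first stage is lost. -/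
lemma ocpCost_shift (hG : S.IsEquilibriumBasis) (hR : S.R.PosDef) (hP : S.P.PosSemidef)
    (hDARE : S.SolvesDARE) (x : Fin nx → ℝ) (v : Fin nz → ℝ) (μ : Fin (n + 1) → Fin nu → ℝ) :
    S.ocpCost (S.A *ᵥ x + S.B *ᵥ μ 0) v (S.shift x v μ)
      + (wsq S.Q (x - S.xbar v) + wsq S.R (μ 0 - S.ubar v)) = S.ocpCost x v μ := by
  have hlast := wsq_lqr hR hP hDARE (S.predState x μ (Fin.last (n + 1)) - S.xbar v)
  have h1 : S.lqrState (S.predState x μ (Fin.last (n + 1))) v 1 - S.xbar v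
      = S.A *ᵥ (S.predState x μ (Fin.last (n + 1)) - S.xbar v)
        + S.B *ᵥ (-(S.K *ᵥ (S.predState x μ (Fin.last (n + 1)) - S.xbar v))) := by
    have h := xbar_equilibrium hG v
    generalize S.predState x μ (Fin.last (n + 1)) = ξ
    change S.A *ᵥ ξ + S.B *ᵥ (S.ubar v - S.K *ᵥ (ξ - S.xbar v)) - S.xbar v = _
    rw [Matrix.mulVec_sub, Matrix.mulVec_neg, Matrix.mulVec_sub S.A]
    conv_lhs => enter [2]; rw [← h]
    abel
  have h2 : S.lqrInput v (S.predState x μ (Fin.last (n + 1))) - S.ubar v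
      = -(S.K *ᵥ (S.predState x μ (Fin.last (n + 1)) - S.xbar v)) := by
    rw [lqrInput]
    abel
  rw [← h1, ← h2] at hlast
  rw [ocpCost, ocpCost, predState_shift_last, ← hlast, Fin.sum_univ_castSucc, Fin.sum_univ_succ]
  simp only [predState_shift_castSucc]
  simp only [Fin.succ_last, shift, Fin.snoc_last, Fin.snoc_castSucc, Fin.tail,
    Fin.castSucc_zero, predState_zero, Fin.succ_castSucc]
  ring

end Shift

/-! ### The feasibility governor -/

section Governor

variable {N : ℕ}

/-- `Gam` is a projection, which for a general closed convex set need not be closed; polyhedrality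
provides closedness. -/
lemma govFeasible_convex_isClosed (hε : S.ε ∈ Set.Ioo (0 : ℝ) 1)
    (hT : IsPolyhedron S.terminalSet) (x : Fin nx → ℝ) :
    Convex ℝ (S.govFeasible N x) ∧ IsClosed (S.govFeasible N x) := by
  have hA := isPolyhedron_admissibleRefs hε
  have hΓ : IsPolyhedron (S.Gam N) :=
    fst_image_ocpGraph (S := S) ▸
      (isPolyhedron_ocpGraph hT).projection_of_finiteDimensional.1
  have hcont : Continuous fun v : Fin nz → ℝ => (x, v) := by fun_prop
  refine ⟨hA.convex.inter fun v hv w hw a b ha hb hab => ?_,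
    hA.isClosed.inter (hΓ.isClosed.preimage hcont)⟩
  have := hΓ.convex (x := (x, v)) (y := (x, w)) hv hw ha hb hab
  simp only [Prod.smul_mk, Prod.mk_add_mk, ← add_smul, hab, one_smul] at this
  exact this

lemma govCost_eq (v : Fin nz → ℝ) :
    S.govCost v = wsq 1 (-S.r + (LinearMap.id : (Fin nz → ℝ) →ₗ[ℝ] _) v) := by
  rw [govCost, enorm2_sq, LinearMap.id_apply, neg_add_eq_sub]

lemma existsUnique_govCost_minimizer {s : Set (Fin nz → ℝ)} (hs : Convex ℝ s) (hsc : IsClosed s)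
    (hne : s.Nonempty) : ∃! v, IsMinimizer S.govCost s v := by
  rw [funext (govCost_eq (S := S))]
  exact (isNonnegQuadratic_wsq Matrix.PosSemidef.one).existsUnique_minimizer _
    (fun v hv => wsq_pos Matrix.PosDef.one hv) _ hs hsc hne

lemma govCost_gain {s : Set (Fin nz → ℝ)} (hs : Convex ℝ s) {a b : Fin nz → ℝ}
    (ha : IsMinimizer S.govCost s a) (hb : b ∈ s) :
    wsq 1 (b - a) ≤ S.govCost b - S.govCost a := by
  rw [funext (govCost_eq (S := S))] at ha
  rw [govCost_eq, govCost_eq]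
  exact (isNonnegQuadratic_wsq Matrix.PosSemidef.one).minimizer_gain LinearMap.id _ hs ha hb

lemma isMinimizer_enorm2_iff {s : Set (Fin nz → ℝ)} {v : Fin nz → ℝ} :
    IsMinimizer (fun v => enorm2 (v - S.r)) s v ↔ IsMinimizer S.govCost s v := by
  refine and_congr_right fun _ => forall₂_congr fun w _ => ?_
  exact (sq_le_sq₀ (norm_nonneg _) (norm_nonneg _)).symm

/-- If an admissible reference optimal at `x` has its equilibrium close to `x`, it is `r⋆`. -/
lemma exists_radius_eq_rStar (hG : S.IsEquilibriumBasis) (hε : S.ε ∈ Set.Ioo (0 : ℝ) 1)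
    (hYzero : (0 : Fin ny → ℝ) ∈ interior S.constraintSet)
    (hQ : S.Q.PosSemidef) (hdet : IsDetectable S.A S.Q) (hR : S.R.PosDef)
    (hP : S.P.PosSemidef) (hDARE : S.SolvesDARE) :
    ∃ ρ, 0 < ρ ∧ ∀ x v, IsMinimizer S.govCost (S.govFeasible N x) v → ‖x - S.xbar v‖ ≤ ρ →
      IsMinimizer S.govCost S.admissibleRefs v := by
  obtain ⟨ρ, hρ, hterm⟩ := exists_terminal_radius hG hε hYzero hQ hdet hR hP hDARE
  refine ⟨ρ / 2, by positivity, fun x v hv hx => ⟨hv.1.1, fun w hw => ?_⟩⟩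
  set c := ‖S.xbar (w - v)‖ with hc
  have hc0 : 0 ≤ c := norm_nonneg _
  -- A step towards w short enough to move the equilibrium state by at most ρ / 2; with the distance
  -- ρ / 2 from x to x̄_v, the total stays within the terminal radius.
  set t := min 1 (ρ / 2 / (c + 1)) with ht
  have ht0 : 0 < t := lt_min one_pos (by positivity)
  have ht1 : t ≤ 1 := min_le_left _ _
  have htc : t * c ≤ ρ / 2 := by
    have h1 : t * (c + 1) ≤ ρ / 2 := by
      rw [← le_div_iff₀ (by positivity)]
      exact min_le_right _ _
    nlinarith
  have hadm : v + t • (w - v) ∈ S.admissibleRefs :=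
    (isPolyhedron_admissibleRefs hε).convex.add_smul_sub_mem hv.1.1 hw ⟨ht0.le, ht1⟩
  have hfeas : v + t • (w - v) ∈ S.govFeasible N x := by
    refine ⟨hadm, terminalSet_subset_Gam (hterm _ hadm x ?_)⟩
    have h1 : x - S.xbar (v + t • (w - v)) = (x - S.xbar v) - t • S.xbar (w - v) := by
      simp only [xbar, Matrix.mulVec_add, Matrix.mulVec_smul]
      abel
    rw [h1]
    refine (norm_sub_le _ _).trans ?_
    rw [norm_smul, Real.norm_of_nonneg ht0.le]
    linarith
  have hmin : S.govCost v ≤ S.govCost (v + t • (w - v)) := hv.2 hfeas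
  have hone := isNonnegQuadratic_wsq (Matrix.PosSemidef.one (n := Fin nz) (R := ℝ))
  have hline := hone.lineMap (v - S.r) (w - S.r) t
  have h1 : v - S.r + t • (w - S.r - (v - S.r)) = v + t • (w - v) - S.r := by
    rw [sub_sub_sub_cancel_right]
    abel
  rw [h1, sub_sub_sub_cancel_right] at hline
  have h2 := hone.nonneg (w - v)
  have h3 : 0 ≤ t * (1 - t) * wsq 1 (w - v) :=
    mul_nonneg (mul_nonneg ht0.le (by linarith)) h2
  simp only [Set.mem_ofPred_eq, govCost, enorm2_sq] at hmin ⊢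
  have h4 : 0 ≤ t * (wsq 1 (w - S.r) - wsq 1 (v - S.r)) := by linarith
  linarith [nonneg_of_mul_nonneg_right h4 ht0]

end Governor

/-! ### Perturbation of the optimal value and the Lyapunov function -/

section ClosedLoop

variable {N : ℕ}

variable (S N) in
/-- The optimal value of the optimal control problem. -/
def ocpValue (x : Fin nx → ℝ) (v : Fin nz → ℝ) : ℝ :=
  S.ocpCost x v (argmin (S.ocpCost x v) (S.ocpFeasible N x v))

/-- The optimal value at a feasible parameter is controlled by the cost of any feasible input
sequence at another parameter. -/
lemma exists_ocpValue_le (hQ : S.Q.PosSemidef) (hR : S.R.PosDef) (hP : S.P.PosSemidef)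
    (hT : IsPolyhedron S.terminalSet) :
    ∃ c, 0 < c ∧ ∀ x v x' v' μ, μ ∈ S.ocpFeasible N x v → (x', v') ∈ S.Gam N → ∀ η, 0 < η →
      S.ocpValue N x' v' ≤ (1 + η) * S.ocpCost x v μ
        + (1 + η⁻¹) * (c * ‖(x', v') - (x, v)‖ ^ 2) := by
  have hq := isNonnegQuadratic_ocpCost (S := S) (N := N) hQ hR hP
  obtain ⟨C, hC, hle⟩ := hq.exists_le
  obtain ⟨L, hL, hlip⟩ :=
    (isPolyhedron_ocpGraph (N := N) hT).projection_of_finiteDimensional.2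
  refine ⟨C * (1 + L) ^ 2, by positivity, fun x v x' v' μ hμ hΓ η hη => ?_⟩
  -- The Lipschitz fibres transport μ to an input sequence feasible at the new parameters, at a
  -- distance proportional to the parameter change.
  obtain ⟨μ', hμ', hdist⟩ := hlip (x, v) μ hμ (x', v') (by rwa [fst_image_ocpGraph])
  have hmin := argmin_isMinimizer (existsUnique_ocp hQ hR hP hT hΓ).exists
  have h1 : S.ocpValue N x' v' ≤ S.ocpCost x' v' μ' := hmin.2 hμ'
  refine h1.trans ?_
  have h2 := hq.add_le hη ((x, v), μ) ((x', v') - (x, v), μ' - μ)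
  have h3 := hle ((x', v') - (x, v), μ' - μ)
  have h4 : ‖(((x', v') - (x, v), μ' - μ) :
      ((Fin nx → ℝ) × (Fin nz → ℝ)) × (Fin N → Fin nu → ℝ))‖
      ≤ (1 + L) * ‖(x', v') - (x, v)‖ := by
    rw [Prod.norm_mk]
    refine max_le ?_ ?_ <;> nlinarith [norm_nonneg ((x', v') - (x, v))]
  have h5 : C * ‖(((x', v') - (x, v), μ' - μ) :
      ((Fin nx → ℝ) × (Fin nz → ℝ)) × (Fin N → Fin nu → ℝ))‖ ^ 2
      ≤ C * (1 + L) ^ 2 * ‖(x', v') - (x, v)‖ ^ 2 := by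
    rw [mul_assoc, ← mul_pow]
    gcongr
  rw [Prod.mk_add_mk, add_sub_cancel, add_sub_cancel] at h2
  refine h2.trans ?_
  have := h3.trans h5
  gcongr

variable [NeZero N]

/-- One step of the closed loop admits a feasible input sequence whose cost is lower by the
stage cost. -/
lemma exists_ocpFeasible_step (hG : S.IsEquilibriumBasis) (hQ : S.Q.PosSemidef)
    (hR : S.R.PosDef) (hP : S.P.PosSemidef) (hDARE : S.SolvesDARE)
    (hT : IsPolyhedron S.terminalSet) {x : Fin nx → ℝ} {v : Fin nz → ℝ}
    (h : (x, v) ∈ S.Gam N) :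
    ∃ ν ∈ S.ocpFeasible N (S.step N x v) v,
      S.ocpCost (S.step N x v) v ν + (wsq S.Q (x - S.xbar v) + wsq S.R (S.mpc N x v - S.ubar v))
        = S.ocpValue N x v := by
  obtain ⟨n, rfl⟩ := Nat.exists_eq_succ_of_ne_zero (NeZero.ne N)
  have hmin := argmin_isMinimizer (existsUnique_ocp hQ hR hP hT h).exists
  exact ⟨_, shift_mem_ocpFeasible hmin.1, ocpCost_shift hG hR hP hDARE x v _⟩

lemma govFeasible_step (hG : S.IsEquilibriumBasis) (hQ : S.Q.PosSemidef)
    (hR : S.R.PosDef) (hP : S.P.PosSemidef) (hDARE : S.SolvesDARE)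
    (hT : IsPolyhedron S.terminalSet) {x : Fin nx → ℝ} {v : Fin nz → ℝ}
    (h : v ∈ S.govFeasible N x) : v ∈ S.govFeasible N (S.step N x v) :=
  let ⟨ν, hν, _⟩ := exists_ocpFeasible_step hG hQ hR hP hDARE hT h.2
  ⟨h.1, ν, hν⟩

/-- A Lyapunov function for the closed loop whose increase is controlled by the change of the
reference. -/
lemma exists_lyapunov (hG : S.IsEquilibriumBasis) (hε : S.ε ∈ Set.Ioo (0 : ℝ) 1)
    (hYzero : (0 : Fin ny → ℝ) ∈ interior S.constraintSet)
    (hQ : S.Q.PosSemidef) (hdet : IsDetectable S.A S.Q) (hR : S.R.PosDef)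
    (hP : S.P.PosSemidef) (hDARE : S.SolvesDARE) (hT : IsPolyhedron S.terminalSet) :
    ∃ (W : (Fin nx → ℝ) → (Fin nz → ℝ) → ℝ) (κ c : ℝ), 0 < κ ∧ 0 ≤ c ∧ (∀ x v, 0 ≤ W x v) ∧
      ∀ x v v', v ∈ S.govFeasible N x → v' ∈ S.govFeasible N (S.step N x v) →
        W (S.step N x v) v' ≤ W x v - κ * ‖x - S.xbar v‖ ^ 2 + c * ‖v' - v‖ ^ 2 := by
  obtain ⟨c₁, hc₁, hval⟩ := exists_ocpValue_le (N := N) hQ hR hP hT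
  obtain ⟨a, C, γ, hC, hγ0, hγ1, hadd, hge, hle, hsto⟩ := exists_storage_norm S.B hQ hdet hR
  obtain ⟨cg, hcg, hGx⟩ := exists_norm_mulVec_le S.Gx
  obtain ⟨ρ, hρ, hterm⟩ := exists_terminal_radius hG hε hYzero hQ hdet hR hP hDARE
  have ha0 : ∀ x, 0 ≤ a x := fun x => (norm_nonneg x).trans (hge x)
  have hq := isNonnegQuadratic_ocpCost (S := S) (N := N) hQ hR hP
  have hJ0 : ∀ x v, 0 ≤ S.ocpValue N x v := fun x v => hq.nonneg ((x, v), _)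
  -- Comparison with the equilibrium state of v, where the LQR sequence is feasible at zero cost; η
  -- = 1 gives the factor 2.
  have hJle : ∀ x v, v ∈ S.govFeasible N x →
      S.ocpValue N x v ≤ 2 * c₁ * a (x - S.xbar v) ^ 2 := by
    intro x v hv
    have h0 : (S.xbar v, v) ∈ S.terminalSet := hterm v hv.1 _ (by simpa using hρ.le)
    have h1 := hval _ _ x v _ (lqr_mem_ocpFeasible h0) hv.2 1 one_pos
    rw [ocpCost_lqr_xbar hG, Prod.mk_sub_mk, sub_self, Prod.norm_mk, norm_zero,
      max_eq_left (norm_nonneg _)] at h1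
    have h2 : ‖x - S.xbar v‖ ^ 2 ≤ a (x - S.xbar v) ^ 2 := by
      gcongr
      exact hge _
    norm_num at h1
    nlinarith
  set γ' := (1 + γ) / 2 with hγ'
  set τ := (1 - γ) / 2 with hτ
  have hτ0 : 0 < τ := by simp only [hτ]; linarith
  -- The storage term decays by τ a². This η makes the relative error η in the optimal value cost at
  -- most τ / 2 · a², leaving half of the decay.
  set η := τ / (2 * (2 * C) * (2 * c₁)) with hη
  have hη0 : 0 < η := by positivity
  set c₂ := (1 + τ⁻¹) * (C * cg) ^ 2 with hc₂
  set c₃ := (1 + η⁻¹) * c₁ with hc₃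
  have hsq : ∀ y d s : ℝ, 0 < s → (y + d) ^ 2 ≤ (1 + s) * y ^ 2 + (1 + s⁻¹) * d ^ 2 := by
    intro y d s hs
    have : (1 + s) * y ^ 2 + (1 + s⁻¹) * d ^ 2 - (y + d) ^ 2 = (s * y - d) ^ 2 / s := by
      field_simp
      ring
    have h0 : 0 ≤ (s * y - d) ^ 2 / s := by positivity
    linarith
  refine ⟨fun x v => 2 * C * S.ocpValue N x v + a (x - S.xbar v) ^ 2, τ / 2, 2 * C * c₃ + c₂,
    by positivity, by positivity,
    fun x v => add_nonneg (mul_nonneg (by positivity) (hJ0 x v)) (sq_nonneg _), ?_⟩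
  intro x v v' hv hv'
  obtain ⟨ν, hν, hνcost⟩ := exists_ocpFeasible_step hG hQ hR hP hDARE hT hv.2
  set x' := S.step N x v with hx'
  set ℓ := wsq S.Q (x - S.xbar v) + wsq S.R (S.mpc N x v - S.ubar v) with hℓ
  have hℓ0 : 0 ≤ ℓ := add_nonneg ((isNonnegQuadratic_wsq hQ).nonneg _)
    ((isNonnegQuadratic_wsq hR.posSemidef).nonneg _)
  have hJ' := hval _ _ x' v' ν hν hv'.2 η hη0
  rw [Prod.mk_sub_mk, sub_self, Prod.norm_mk, norm_zero, max_eq_right (norm_nonneg _),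
    ← mul_assoc] at hJ'
  have ha1 := hsto (x - S.xbar v) (S.mpc N x v - S.ubar v)
  have hxv : S.A *ᵥ (x - S.xbar v) + S.B *ᵥ (S.mpc N x v - S.ubar v) = x' - S.xbar v := by
    conv_rhs => rw [← xbar_equilibrium hG v]
    rw [hx', step, Matrix.mulVec_sub, Matrix.mulVec_sub]
    abel
  rw [hxv] at ha1
  have ha2 : a (x' - S.xbar v') ≤ a (x' - S.xbar v) + C * cg * ‖v' - v‖ := by
    have h1 : x' - S.xbar v' = (x' - S.xbar v) + S.Gx *ᵥ (v - v') := by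
      simp only [xbar, Matrix.mulVec_sub]
      abel
    rw [h1, norm_sub_rev, mul_assoc]
    refine (hadd _ _).trans ?_
    gcongr
    exact (hle _).trans (by gcongr; exact hGx _)
  have ha3 : a (x' - S.xbar v') ^ 2 ≤ (1 + τ) * a (x' - S.xbar v) ^ 2 + c₂ * ‖v' - v‖ ^ 2 := by
    calc a (x' - S.xbar v') ^ 2 ≤ (a (x' - S.xbar v) + C * cg * ‖v' - v‖) ^ 2 := by
          gcongr
          exact ha0 _
      _ ≤ _ := hsq _ _ τ hτ0
      _ = _ := by rw [hc₂]; ring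
  have ha4 : (1 + τ) * a (x' - S.xbar v) ^ 2
      ≤ γ' * a (x - S.xbar v) ^ 2 + 2 * C * ℓ := by
    have h1 : (1 + τ) * a (x' - S.xbar v) ^ 2
        ≤ (1 + τ) * (γ * a (x - S.xbar v) ^ 2 + C * ℓ) := by gcongr
    have h2 : (1 + τ) * γ ≤ γ' := by
      simp only [hτ, hγ']
      nlinarith [sq_nonneg (1 - γ)]
    have h3 : 1 + τ ≤ 2 := by simp only [hτ]; linarith
    have h4 : (1 + τ) * γ * a (x - S.xbar v) ^ 2 ≤ γ' * a (x - S.xbar v) ^ 2 := by gcongr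
    have h5 : (1 + τ) * (C * ℓ) ≤ 2 * (C * ℓ) := by gcongr
    linarith
  have hJ'' : 2 * C * S.ocpValue N x' v'
      ≤ 2 * C * S.ocpValue N x v - 2 * C * ℓ + τ / 2 * a (x - S.xbar v) ^ 2
        + 2 * C * c₃ * ‖v' - v‖ ^ 2 := by
    have h1 : S.ocpCost x' v ν = S.ocpValue N x v - ℓ := by linarith
    have h2 : η * S.ocpValue N x v ≤ η * (2 * c₁ * a (x - S.xbar v) ^ 2) := by
      gcongr
      exact hJle x v hv
    have h3 : 2 * C * (η * (2 * c₁ * a (x - S.xbar v) ^ 2)) = τ / 2 * a (x - S.xbar v) ^ 2 := by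
      rw [hη]
      field_simp
    have h4 : 2 * C * (η * S.ocpValue N x v) ≤ 2 * C * (η * (2 * c₁ * a (x - S.xbar v) ^ 2)) := by
      gcongr
    have h5 : 0 ≤ 2 * C * (η * ℓ) := by positivity
    have h6 : 2 * C * S.ocpValue N x' v'
        ≤ 2 * C * ((1 + η) * (S.ocpValue N x v - ℓ) + c₃ * ‖v' - v‖ ^ 2) := by
      rw [h1] at hJ'
      gcongr
    linarith
  have hge2 : ‖x - S.xbar v‖ ^ 2 ≤ a (x - S.xbar v) ^ 2 := by
    gcongr
    exact hge _
  have hτγ : γ' = 1 - τ := by simp only [hτ, hγ']; ring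
  rw [hτγ] at ha4
  have h7 : τ / 2 * ‖x - S.xbar v‖ ^ 2 ≤ τ / 2 * a (x - S.xbar v) ^ 2 := by gcongr
  linarith

end ClosedLoop

end Setup

end FeasGov

end

/-! ### Finite-time convergence -/

theorem theorem4 {nx nu ny nz m : ℕ} (S : FeasGov.Setup nx nu ny nz m)
    (N : ℕ) [NeZero N]
    (hG : S.IsEquilibriumBasis)
    (hε : S.ε ∈ Set.Ioo (0 : ℝ) 1)
    (hstab : FeasGov.IsStabilizable S.A S.B)
    (hGz : IsUnit S.Gz)
    (hYcompact : IsCompact S.constraintSet)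
    (hYzero : (0 : Fin ny → ℝ) ∈ interior S.constraintSet)
    (hQ : S.Q.PosSemidef)
    (hdet : FeasGov.IsDetectable S.A S.Q)
    (hR : S.R.PosDef)
    (hP : S.P.PosSemidef)
    (hDARE : S.SolvesDARE) :
    -- the reference `r⋆` is well defined
    (∃! v, FeasGov.IsMinimizer (fun v => FeasGov.enorm2 (v - S.r)) S.admissibleRefs v) ∧
    ∀ x₀ ∈ Prod.fst '' S.Lam N,
      -- the closed loop is well defined: both optimization problems have unique solutions
      (∀ k : ℕ,
        (∃! v, FeasGov.IsMinimizer S.govCost (S.govFeasible N (S.stateSeq N x₀ k)) v) ∧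
        (∃! μ, FeasGov.IsMinimizer (S.ocpCost (S.stateSeq N x₀ k) (S.refSeq N x₀ k))
          (S.ocpFeasible N (S.stateSeq N x₀ k) (S.refSeq N x₀ k)) μ)) ∧
      -- finite-time convergence
      ∃ t : ℕ, ∀ k ≥ t, S.refSeq N x₀ k = S.rStar := by
  open FeasGov FeasGov.Setup in
  have hT := isPolyhedron_terminalSet hG hε hYcompact hYzero hQ hdet hR hP hDARE
  have hA := isPolyhedron_admissibleRefs hε
  have hstar := existsUnique_govCost_minimizer (S := S) hA.convex hA.isClosed
    ⟨0, zero_mem_admissibleRefs hYzero⟩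
  have hstar' : ∃! v, IsMinimizer (fun v => enorm2 (v - S.r)) S.admissibleRefs v := by
    simpa only [isMinimizer_enorm2_iff] using hstar
  have hrStar : IsMinimizer S.govCost S.admissibleRefs S.rStar :=
    isMinimizer_enorm2_iff.1 (argmin_isMinimizer hstar'.exists)
  refine ⟨hstar', ?_⟩
  rintro _ ⟨⟨x₀, v₀⟩, ⟨hv₀, -, hv₀'⟩, rfl⟩
  have hgov : ∀ x, (S.govFeasible N x).Nonempty →
      ∃! v, IsMinimizer S.govCost (S.govFeasible N x) v := fun x hx =>
    existsUnique_govCost_minimizer (govFeasible_convex_isClosed hε hT x).1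
      (govFeasible_convex_isClosed hε hT x).2 hx
  have hstep : ∀ {x v}, v ∈ S.govFeasible N x → v ∈ S.govFeasible N (S.step N x v) :=
    govFeasible_step hG hQ hR hP hDARE hT
  have hne : ∀ k, (S.govFeasible N (S.stateSeq N x₀ k)).Nonempty := by
    intro k
    induction k with
    | zero => exact ⟨v₀, hv₀', hv₀⟩
    | succ k ih => exact ⟨_, hstep (argmin_isMinimizer (hgov _ ih).exists).1⟩
  have hmin : ∀ k, IsMinimizer S.govCost (S.govFeasible N (S.stateSeq N x₀ k))
      (S.refSeq N x₀ k) := fun k => argmin_isMinimizer (hgov _ (hne k)).exists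
  have hnext : ∀ k, S.refSeq N x₀ k ∈ S.govFeasible N (S.stateSeq N x₀ (k + 1)) := fun k =>
    hstep (hmin k).1
  refine ⟨fun k => ⟨hgov _ (hne k), existsUnique_ocp hQ hR hP hT (hmin k).1.2⟩, ?_⟩
  obtain ⟨ρ, hρ, hclose⟩ :=
    exists_radius_eq_rStar (N := N) hG hε hYzero hQ hdet hR hP hDARE
  obtain ⟨W, κ, c, hκ, hc, hW0, hW⟩ :=
    exists_lyapunov (N := N) hG hε hYzero hQ hdet hR hP hDARE hT
  have hcost0 : ∀ v, 0 ≤ S.govCost v := fun v => sq_nonneg _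
  obtain ⟨t, ht⟩ : ∃ t, ‖S.stateSeq N x₀ t - S.xbar (S.refSeq N x₀ t)‖ ≤ ρ := by
    by_contra! hfar
    -- The weight c is the Lyapunov error constant, so the drop of the governor cost cancels the
    -- error from the reference change.
    have hdecr : ∀ k, W (S.stateSeq N x₀ k) (S.refSeq N x₀ k) + c * S.govCost (S.refSeq N x₀ k)
        ≤ W (S.stateSeq N x₀ 0) (S.refSeq N x₀ 0) + c * S.govCost (S.refSeq N x₀ 0)
          - k * (κ * ρ ^ 2) := by
      intro k
      induction k with
      | zero => simp
      | succ k ih =>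
        have h1 := hW _ _ _ (hmin k).1 (hmin (k + 1)).1
        have h2 := govCost_gain (govFeasible_convex_isClosed hε hT _).1 (hmin (k + 1)) (hnext k)
        have h3 : ‖S.refSeq N x₀ (k + 1) - S.refSeq N x₀ k‖ ^ 2
            ≤ S.govCost (S.refSeq N x₀ k) - S.govCost (S.refSeq N x₀ (k + 1)) := by
          rw [norm_sub_rev]
          refine (norm_sq_le_dotProduct _).trans ?_
          simpa [wsq] using h2
        have h4 := mul_le_mul_of_nonneg_left h3 hc
        have h5 : κ * ρ ^ 2 ≤ κ * ‖S.stateSeq N x₀ k - S.xbar (S.refSeq N x₀ k)‖ ^ 2 := by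
          have := (hfar k).le
          gcongr
        have h6 : S.step N (S.stateSeq N x₀ k) (S.refSeq N x₀ k) = S.stateSeq N x₀ (k + 1) := rfl
        rw [h6] at h1
        push_cast
        linarith
    obtain ⟨k, hk⟩ := exists_nat_gt ((W (S.stateSeq N x₀ 0) (S.refSeq N x₀ 0)
      + c * S.govCost (S.refSeq N x₀ 0)) / (κ * ρ ^ 2))
    rw [div_lt_iff₀ (by positivity)] at hk
    linarith [hdecr k, hW0 (S.stateSeq N x₀ k) (S.refSeq N x₀ k),
      mul_nonneg hc (hcost0 (S.refSeq N x₀ k))]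
  refine ⟨t, fun k hk => ?_⟩
  induction k, hk using Nat.le_induction with
  | base => exact hstar.unique (hclose _ _ (hmin t) ht) hrStar
  | succ k hk ih =>
    -- r⋆ is still a candidate at the next state, so the new choice costs no more than the optimum
    -- over all of R_ε.
    refine hstar.unique ⟨(hmin (k + 1)).1.1, fun w hw => ?_⟩ hrStar
    have h1 : S.govCost (S.refSeq N x₀ (k + 1)) ≤ S.govCost (S.refSeq N x₀ k) :=
      (hmin (k + 1)).2 (hnext k)
    rw [ih] at h1
    exact h1.trans (hrStar.2 hw)
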